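/- Let $X$ be a real Banach lattice, $E$ a real Banach space, $1\le p\le\infty$ and $\frac1p+\frac1{p^*}=1$. The dual $X^*$ carries its dual order ($f\ge 0$ iff $f(x)\ge 0$ for all $x\ge 0$), and "operator" means bounded linear operator. For a sequence $(u_n)_n$ in a Banach space $F$ put $\|(u_n)_n\|_p=(\sum_n\|u_n\|^p)^{1/p}$ and $\|(u_n)_n\|_p^w=\sup_{\|\varphi\|_{F^*}\le 1}(\sum_n|\varphi(u_n)|^p)^{1/p}$ (suprema over $n$ if $p=\infty$). Let $\ell_p(F)$ be the space of sequences with $\|(u_n)_n\|_p<\infty$ if $p<\infty$, and the space of norm-null sequences if $p=\infty$; let $\ell_p^w(F)$ be the space of sequences with $\|(u_n)_n\|_p^w<\infty$ ($1\le p\le \infty$). An operator $S$ from a Banach space $F$ into a Banach lattice $Y$ is *latticially $p$-nuclear* if $S=\sum_{j=1}^\infty f_j\otimes y_j$ (convergence in operator norm) with $(f_j)_j\in\ell_p(F^*)$, $(y_j)_j\in\ell^w_{p^*}(Y)$ and all $y_j\ge 0$; $\widetilde\nu_p(S)$ is the infimum of $\|(f_j)_j\|_p\,\|(y_j)_j\|_{p^*}^w$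 over all such representations. An operator $T:X\to E$ is *positively $p$-nuclear* if $T=\sum_{j=1}^\infty x_j^*\otimes u_j$ (convergence in operator norm) with $(x_j^*)_j\in\ell^w_{p^*}(X^*)$, all $x_j^*\ge 0$, and $(u_j)_j\in\ell_p(E)$; $\widetilde\nu^p(T)$ is the infimum of $\|(x_j^*)_j\|_{p^*}^w\,\|(u_j)_j\|_p$ over all such representations. A Banach space $F$ has the *approximation property* (AP) if for every $\varepsilon>0$ and every compact $K\subset F$ there is a finite rank operator $R$ on $F$ with $\|Ru-u\|<\varepsilon$ for all $u\in K$. A Banach lattice $Y$ has the *positive metric approximation property* (PMAP) if for every $\varepsilon>0$ and every compact $K\subset Y$ there is a positive finite rank operator $R$ on $Y$ with $\|R\|\le 1$ and $\|Ry-y\|<\varepsilon$ for all $y\in K$. **Theorem.** Suppose that $E^{***}$ has the AP or $X^*$ has the PMAP. If $T:X\to E$ is an operator whose adjoint $T^*:E^*\to X^*$ is latticially $p$-nuclear, then $T$ is positively $p$-nuclear and $\widetilde\nu^p(T)=\widetilde\nu_p(T^*)$. -/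

import Mathlib

set_option maxSynthPendingDepth 3

open scoped ENNReal
open Filter Topology

namespace BanachLattice

/-! ### Order on the dual, positive operators, adjoints -/

/-- The order of the dual Banach lattice `X^*`: `f ≤ g` iff `f x ≤ g x` for all `x ≥ 0`. -/
instance dualPartialOrder (X : Type*) [NormedAddCommGroup X] [NormedSpace ℝ X] [Lattice X]
    [IsOrderedAddMonoid X] : PartialOrder (StrongDual ℝ X) where
  le f g := ∀ x : X, 0 ≤ x → f x ≤ g x
  le_refl _ _ _ := le_rfl
  le_trans _ _ _ hfg hgh x hx := (hfg x hx).trans (hgh x hx)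
  le_antisymm f g hfg hgf := by
    have h : ∀ x : X, 0 ≤ x → f x = g x := fun x hx => le_antisymm (hfg x hx) (hgf x hx)
    ext x
    rw [← posPart_sub_negPart x, map_sub, map_sub, h _ (posPart_nonneg x),
      h _ (negPart_nonneg x)]

/-- An operator is positive if it maps nonnegative vectors to nonnegative vectors. -/
def IsPositiveOp {X Y : Type*} [NormedAddCommGroup X] [NormedSpace ℝ X] [PartialOrder X]
    [NormedAddCommGroup Y] [NormedSpace ℝ Y] [PartialOrder Y] (R : X →L[ℝ] Y) : Prop :=
  ∀ x : X, 0 ≤ x → 0 ≤ R x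

/-- An operator of finite rank. -/
def IsFiniteRank {E F : Type*} [NormedAddCommGroup E] [NormedSpace ℝ E]
    [NormedAddCommGroup F] [NormedSpace ℝ F] (S : E →L[ℝ] F) : Prop :=
  FiniteDimensional ℝ (LinearMap.range (S : E →ₗ[ℝ] F))

/-- The Banach space adjoint `T^* : F^* → E^*`, `T^* f = f ∘ T`. -/
noncomputable def adjointOp {E F : Type*} [NormedAddCommGroup E] [NormedSpace ℝ E]
    [NormedAddCommGroup F] [NormedSpace ℝ F] (T : E →L[ℝ] F) :
    StrongDual ℝ F →L[ℝ] StrongDual ℝ E :=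
  T.precomp ℝ

/-! ### Approximation properties -/

/-- The approximation property: the identity is approximated by finite rank operators, uniformly
on compact sets. -/
def HasAP (E : Type*) [NormedAddCommGroup E] [NormedSpace ℝ E] : Prop :=
  ∀ ε : ℝ, 0 < ε → ∀ K : Set E, IsCompact K →
    ∃ S : E →L[ℝ] E, IsFiniteRank S ∧ ∀ u ∈ K, ‖S u - u‖ < ε

/-- The positive metric approximation property: the identity is approximated by positive finite
rank operators of norm at most one, uniformly on compact sets. -/
def HasPMAP (X : Type*) [NormedAddCommGroup X] [NormedSpace ℝ X] [PartialOrder X] : Prop :=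
  ∀ ε : ℝ, 0 < ε → ∀ K : Set X, IsCompact K →
    ∃ R : X →L[ℝ] X, IsFiniteRank R ∧ IsPositiveOp R ∧ ‖R‖ ≤ 1 ∧ ∀ x ∈ K, ‖R x - x‖ < ε

/-! ### Strong and weak `p`-norms of sequences -/

/-- `‖(u_n)‖_p = (∑ ‖u_n‖ ^ p) ^ (1 / p)` for `p < ∞` and `sup ‖u_n‖` for `p = ∞`, as an element
of `[0, ∞]`. -/
noncomputable def strongNorm {E : Type*} [NormedAddCommGroup E] (p : ℝ≥0∞) (u : ℕ → E) : ℝ≥0∞ :=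
  if p = ∞ then ⨆ n, ‖u n‖ₑ else (∑' n, ‖u n‖ₑ ^ p.toReal) ^ (1 / p.toReal)

/-- `‖(u_n)‖_p^w`, the supremum of `‖(φ (u_n))‖_p` over `φ` in the closed unit ball of the dual. -/
noncomputable def weakNorm {E : Type*} [NormedAddCommGroup E] [NormedSpace ℝ E]
    (p : ℝ≥0∞) (u : ℕ → E) : ℝ≥0∞ :=
  ⨆ (φ : StrongDual ℝ E) (_ : ‖φ‖ ≤ 1), strongNorm p fun n => φ (u n)

/-- `p`-summable sequences: `∑ ‖u_n‖ ^ p < ∞` for `p < ∞`, and, with the convention usual for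
nuclear operators, norm-null sequences for `p = ∞`. -/
def IsPSummable {E : Type*} [NormedAddCommGroup E] (p : ℝ≥0∞) (u : ℕ → E) : Prop :=
  strongNorm p u < ∞ ∧ (p = ∞ → Tendsto u atTop (𝓝 0))

/-- Weakly `p`-summable sequences (the weakly bounded ones for `p = ∞`). -/
def IsWeaklyPSummable {E : Type*} [NormedAddCommGroup E] [NormedSpace ℝ E]
    (p : ℝ≥0∞) (u : ℕ → E) : Prop :=
  weakNorm p u < ∞

/-! ### Latticially and positively `p`-nuclear operators -/

section Nuclear

variable {E X : Type*} [NormedAddCommGroup E] [NormedSpace ℝ E]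
  [NormedAddCommGroup X] [NormedSpace ℝ X]

/-- `S = ∑ f_j ⊗ x_j` with `(f_j)` a `p`-summable sequence in `E^*` and `(x_j)` a weakly
`p^*`-summable sequence of nonnegative vectors of `X`. Here `(f ⊗ x) u = f u • x`. -/
structure IsLatticiallyNuclearRep [PartialOrder X] (p : ℝ≥0∞) (S : E →L[ℝ] X)
    (f : ℕ → StrongDual ℝ E) (x : ℕ → X) : Prop where
  summable : IsPSummable p f
  weaklySummable : IsWeaklyPSummable p.conjExponent x
  nonneg : ∀ j, 0 ≤ x j
  hasSum : HasSum (fun j => (f j).smulRight (x j)) S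

/-- Latticially `p`-nuclear operators. -/
def IsLatticiallyNuclear [PartialOrder X] (p : ℝ≥0∞) (S : E →L[ℝ] X) : Prop :=
  ∃ (f : ℕ → StrongDual ℝ E) (x : ℕ → X), IsLatticiallyNuclearRep p S f x

/-- The latticially `p`-nuclear norm (equal to `∞` if there is no representation). -/
noncomputable def latticiallyNuclearNorm [PartialOrder X] (p : ℝ≥0∞) (S : E →L[ℝ] X) : ℝ≥0∞ :=
  ⨅ (f : ℕ → StrongDual ℝ E) (x : ℕ → X) (_ : IsLatticiallyNuclearRep p S f x),
    strongNorm p f * weakNorm p.conjExponent x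

/-- `T = ∑ f_j ⊗ u_j` with `(f_j)` a weakly `p^*`-summable sequence of nonnegative functionals on
`X` and `(u_j)` a `p`-summable sequence in `E`. -/
structure IsPositivelyNuclearRep [Lattice X] [IsOrderedAddMonoid X] (p : ℝ≥0∞) (T : X →L[ℝ] E)
    (f : ℕ → StrongDual ℝ X) (u : ℕ → E) : Prop where
  weaklySummable : IsWeaklyPSummable p.conjExponent f
  nonneg : ∀ j, 0 ≤ f j
  summable : IsPSummable p u
  hasSum : HasSum (fun j => (f j).smulRight (u j)) T

/-- Positively `p`-nuclear operators. -/
def IsPositivelyNuclear [Lattice X] [IsOrderedAddMonoid X] (p : ℝ≥0∞) (T : X →L[ℝ] E) : Prop :=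
  ∃ (f : ℕ → StrongDual ℝ X) (u : ℕ → E), IsPositivelyNuclearRep p T f u

/-- The positively `p`-nuclear norm (equal to `∞` if there is no representation). -/
noncomputable def positivelyNuclearNorm [Lattice X] [IsOrderedAddMonoid X] (p : ℝ≥0∞)
    (T : X →L[ℝ] E) : ℝ≥0∞ :=
  ⨅ (f : ℕ → StrongDual ℝ X) (u : ℕ → E) (_ : IsPositivelyNuclearRep p T f u),
    weakNorm p.conjExponent f * strongNorm p u

end Nuclear

end BanachLattice

/-! Put V = X^* ⊗ E with the gauge of the finite sums ∑ a_j ⊗ u_j, a_j ≥ 0, ‖(a_j)‖_q^w ≤ 1,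
‖(u_j)‖_p ≤ 1, where q = p^*. A representation T^* = ∑ f_j ⊗ y_j has its f_j in E^{**}, so it does
not define an element of V. The second adjoints of u ↦ y_j ⊗ u do carry the f_j into V^{**}, and z =
∑ (y_j ⊗ ·)^{**}(f_j) converges there with norm at most ‖(y_j)‖_q^w ‖(f_j)‖_p.

If z lies in the closure of V, a rapidly converging sequence t_n → z can be telescoped. Its
differences have finite positive representations with summable norms, and laying these out in one
sequence represents T with almost the same norms (`exists_isPositivelyNuclearRep`).

By Hahn–Banach, membership in the closure means Ψ(z) = 0 for every Ψ ∈ V^{***} vanishing on V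
(`exists_norm_tsum_sub_lt`). Such a Ψ gives U : X^* → E^{***} with values in the annihilator of E,
and Ψ(z) = ∑ U(y_j)(f_j) is a formal trace. Since ∑ y_j(x) f_j = Tx lies in E, ∑ ψ(f_j) y_j = 0
whenever ψ annihilates E (`hasSum_apply_smul_zero`). So Ψ(z) is the trace of a representation of a
zero operator, and it vanishes by the AP of E^{***} (`HasAP.tsum_apply_eq_zero`) or the PMAP of X^*
(`HasPMAP.hasSum_apply_eq_zero`). The estimates behind both pass from E to its higher duals by
`sum_mul_norm_comp_le`.

The reverse inequality of norms needs no approximation: take adjoints and embed E isometrically in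
E^{**}. -/

namespace BanachLattice

/-! ### The `ℓ_p`-norm of a family of extended nonnegative numbers -/

/-- The `ℓ_p`-norm of a family in `[0, ∞]`. -/
noncomputable def lpSize {ι : Type*} (p : ℝ≥0∞) (w : ι → ℝ≥0∞) : ℝ≥0∞ :=
  if p = ∞ then ⨆ n, w n else (∑' n, w n ^ p.toReal) ^ (1 / p.toReal)

lemma strongNorm_eq_lpSize {E : Type*} [NormedAddCommGroup E] (p : ℝ≥0∞) (u : ℕ → E) :
    strongNorm p u = lpSize p fun n => ‖u n‖ₑ := rfl

section lpSize

variable {ι κ : Type*} {p : ℝ≥0∞}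

lemma lpSize_top (w : ι → ℝ≥0∞) : lpSize ∞ w = ⨆ n, w n := if_pos rfl

lemma lpSize_of_ne_top (hp : p ≠ ∞) (w : ι → ℝ≥0∞) :
    lpSize p w = (∑' n, w n ^ p.toReal) ^ (1 / p.toReal) := if_neg hp

lemma toReal_pos_of_one_le (hp1 : 1 ≤ p) (hp : p ≠ ∞) : 0 < p.toReal :=
  ENNReal.toReal_pos (zero_lt_one.trans_le hp1).ne' hp

lemma lpSize_rpow (hp1 : 1 ≤ p) (hp : p ≠ ∞) (w : ι → ℝ≥0∞) :
    lpSize p w ^ p.toReal = ∑' n, w n ^ p.toReal := by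
  rw [lpSize_of_ne_top hp, ← ENNReal.rpow_mul,
    one_div_mul_cancel (toReal_pos_of_one_le hp1 hp).ne', ENNReal.rpow_one]

lemma lpSize_le_iff (hp1 : 1 ≤ p) (hp : p ≠ ∞) (w : ι → ℝ≥0∞) (c : ℝ≥0∞) :
    lpSize p w ≤ c ↔ ∑' n, w n ^ p.toReal ≤ c ^ p.toReal := by
  rw [← lpSize_rpow hp1 hp, ENNReal.rpow_le_rpow_iff (toReal_pos_of_one_le hp1 hp)]

lemma lpSize_mono {v w : ι → ℝ≥0∞} (h : ∀ n, v n ≤ w n) :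
    lpSize p v ≤ lpSize p w := by
  unfold lpSize
  split_ifs
  · exact iSup_mono h
  · gcongr with n
    exact h n

lemma lpSize_equiv (e : κ ≃ ι) (w : ι → ℝ≥0∞) : lpSize p (w ∘ e) = lpSize p w := by
  unfold lpSize
  split_ifs
  · exact e.iSup_comp (g := w)
  · congr 1
    exact e.tsum_eq fun n => w n ^ p.toReal

lemma lpSize_const_mul (hp1 : 1 ≤ p) (c : ℝ≥0∞) (w : ι → ℝ≥0∞) :
    lpSize p (fun n => c * w n) = c * lpSize p w := by
  by_cases hp : p = ∞
  · subst hp; rw [lpSize_top, lpSize_top, ENNReal.mul_iSup]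
  · have h0 := toReal_pos_of_one_le hp1 hp
    rw [lpSize_of_ne_top hp, lpSize_of_ne_top hp]
    simp_rw [ENNReal.mul_rpow_of_nonneg _ _ h0.le, ENNReal.tsum_mul_left]
    rw [ENNReal.mul_rpow_of_nonneg _ _ (by positivity), ← ENNReal.rpow_mul,
      mul_one_div_cancel h0.ne', ENNReal.rpow_one]

lemma le_lpSize (hp1 : 1 ≤ p) (w : ι → ℝ≥0∞) (n : ι) : w n ≤ lpSize p w := by
  by_cases hp : p = ∞
  · subst hp; rw [lpSize_top]; exact le_iSup w n
  · rw [← ENNReal.rpow_le_rpow_iff (toReal_pos_of_one_le hp1 hp), lpSize_rpow hp1 hp]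
    exact ENNReal.le_tsum n

lemma lpSize_le_of_single (hp1 : 1 ≤ p) {w : ι → ℝ≥0∞} (i : ι) (h : ∀ n, n ≠ i → w n = 0) :
    lpSize p w ≤ w i := by
  by_cases hp : p = ∞
  · subst hp; rw [lpSize_top]
    refine iSup_le fun n => ?_
    by_cases hn : n = i
    · rw [hn]
    · rw [h n hn]; exact zero_le
  · rw [lpSize_le_iff hp1 hp, tsum_eq_single i]
    intro n hn
    rw [h n hn, ENNReal.zero_rpow_of_pos (toReal_pos_of_one_le hp1 hp)]

/-- The unit ball for the `ℓ_p`-norm of concatenations. -/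
lemma lpSize_sum_le_one (hp1 : 1 ≤ p) {v : ι → ℝ≥0∞} {w : κ → ℝ≥0∞} {s t : ℝ}
    (hs : 0 ≤ s) (ht : 0 ≤ t) (hst : s + t = 1) (hv : lpSize p v ≤ 1) (hw : lpSize p w ≤ 1) :
    lpSize p (Sum.elim (fun n => ENNReal.ofReal (s ^ (p⁻¹).toReal) * v n)
      (fun n => ENNReal.ofReal (t ^ (p⁻¹).toReal) * w n)) ≤ 1 := by
  -- For `p = ∞` the exponent `(p⁻¹).toReal` is 0, so both weights equal 1, even when `s` or `t` is
  -- 0.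
  by_cases hp : p = ∞
  · subst hp
    rw [lpSize_top] at *
    simpa using ⟨by simpa using hv, by simpa using hw⟩
  · have h0 := toReal_pos_of_one_le hp1 hp
    rw [lpSize_le_iff hp1 hp, ENNReal.one_rpow] at *
    rw [Summable.tsum_sum (by exact ENNReal.summable) (by exact ENNReal.summable)]
    have key : ∀ r : ℝ, 0 ≤ r → ENNReal.ofReal (r ^ (p⁻¹).toReal) ^ p.toReal
        = ENNReal.ofReal r := fun r hr => by
      rw [ENNReal.ofReal_rpow_of_nonneg (by positivity) h0.le, ← Real.rpow_mul hr,
        ENNReal.toReal_inv, inv_mul_cancel₀ h0.ne', Real.rpow_one]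
    simp_rw [Sum.elim_inl, Sum.elim_inr, ENNReal.mul_rpow_of_nonneg _ _ h0.le,
      ENNReal.tsum_mul_left, key s hs, key t ht]
    calc _ ≤ ENNReal.ofReal s * 1 + ENNReal.ofReal t * 1 := by gcongr
      _ = 1 := by rw [mul_one, mul_one, ← ENNReal.ofReal_add hs ht, hst, ENNReal.ofReal_one]

/-- The `ℓ_p`-norm of a double family is at most the sum of the norms of its rows. -/
lemma lpSize_prod_le (hp1 : 1 ≤ p) (w : ι × κ → ℝ≥0∞) :
    lpSize p w ≤ ∑' i, lpSize p fun k => w (i, k) := by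
  by_cases hp : p = ∞
  · subst hp
    rw [lpSize_top]
    refine iSup_le fun ⟨i, k⟩ => ?_
    refine le_trans ?_ (ENNReal.le_tsum i)
    rw [lpSize_top]
    exact le_iSup (fun k => w (i, k)) k
  · have h0 := toReal_pos_of_one_le hp1 hp
    have h1 : 1 ≤ p.toReal := by
      rw [← ENNReal.toReal_one]; exact ENNReal.toReal_mono hp hp1
    rw [lpSize_le_iff hp1 hp, ENNReal.tsum_prod']
    simp_rw [fun i => (lpSize_rpow hp1 hp (fun k => w (i, k))).symm]
    set N : ι → ℝ≥0∞ := fun i => lpSize p fun k => w (i, k)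
    set S := ∑' i, N i
    have hsplit : ∀ x : ℝ≥0∞, x ^ p.toReal = x * x ^ (p.toReal - 1) := fun x => by
      conv_rhs => enter [1]; rw [← ENNReal.rpow_one x]
      rw [← ENNReal.rpow_add_of_nonneg _ _ zero_le_one (by linarith)]; congr 1; ring
    -- Each N_i is at most S, hence N_i^p ≤ N_i S^(p-1); summing over i gives S^p.
    calc ∑' i, N i ^ p.toReal ≤ ∑' i, N i * S ^ (p.toReal - 1) := by
          refine ENNReal.tsum_le_tsum fun i => ?_
          rw [hsplit]
          exact mul_le_mul_right (ENNReal.rpow_le_rpow (ENNReal.le_tsum i) (by linarith)) _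
      _ = S ^ p.toReal := by rw [ENNReal.tsum_mul_right, hsplit S]

/-- Hölder's inequality. -/
lemma tsum_mul_le_lpSize_mul_lpSize (p q : ℝ≥0∞) [hpq : ENNReal.HolderConjugate p q]
    (v w : ι → ℝ≥0∞) : ∑' n, v n * w n ≤ lpSize p v * lpSize q w := by
  have hp1 : 1 ≤ p := ENNReal.HolderConjugate.one_le p q
  have hq1 : 1 ≤ q := ENNReal.HolderConjugate.one_le q p
  by_cases hp : p = ∞
  · subst hp
    have : q = 1 := by
      have := ENNReal.holderConjugate_iff.1 hpq
      simpa using this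
    subst this
    rw [lpSize_of_ne_top ENNReal.one_ne_top, lpSize_top]
    simp only [ENNReal.toReal_one, ENNReal.rpow_one, div_one]
    rw [← ENNReal.tsum_mul_left]
    gcongr with n
    exact le_iSup v n
  by_cases hq : q = ∞
  · subst hq
    have : p = 1 := by
      have := ENNReal.holderConjugate_iff.1 hpq
      simpa using this
    subst this
    rw [lpSize_of_ne_top ENNReal.one_ne_top, lpSize_top]
    simp only [ENNReal.toReal_one, ENNReal.rpow_one, div_one]
    rw [← ENNReal.tsum_mul_right]
    gcongr with n
    exact le_iSup w n
  · have hr : p.toReal.HolderConjugate q.toReal :=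
      ENNReal.HolderConjugate.toReal_of_ne_top hp hq
    rw [ENNReal.tsum_eq_iSup_sum]
    refine iSup_le fun s => (ENNReal.inner_le_Lp_mul_Lq s v w hr).trans ?_
    rw [lpSize_of_ne_top hp, lpSize_of_ne_top hq]
    gcongr <;> exact ENNReal.sum_le_tsum s

/-- Small tails. -/
lemma exists_finset_lpSize_indicator_le (hp1 : 1 ≤ p) {w : ℕ → ℝ≥0∞} (hw : lpSize p w < ∞)
    (h0 : p = ∞ → Tendsto w atTop (𝓝 0)) {ε : ℝ≥0∞} (hε : 0 < ε) :
    ∃ s : Finset ℕ, ∀ J : Finset ℕ, Disjoint J s →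
      lpSize p ((J : Set ℕ).indicator w) ≤ ε := by
  by_cases hp : p = ∞
  · obtain ⟨N, hN⟩ := eventually_atTop.1 ((h0 hp).eventually (Iic_mem_nhds hε))
    refine ⟨Finset.range N, fun J hJ => ?_⟩
    subst hp
    rw [lpSize_top]
    refine iSup_le fun n => ?_
    by_cases hn : n ∈ J
    · rw [Set.indicator_of_mem (by exact_mod_cast hn)]
      exact hN n (by simpa using Finset.disjoint_left.1 hJ hn)
    · rw [Set.indicator_of_notMem (by exact_mod_cast hn)]; exact zero_le
  · have hpos := toReal_pos_of_one_le hp1 hp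
    have hfin : ∑' n, w n ^ p.toReal ≠ ∞ := by
      rw [← lpSize_rpow hp1 hp]
      exact (ENNReal.rpow_lt_top_of_nonneg hpos.le hw.ne).ne
    have hε' : 0 < ε ^ p.toReal := ENNReal.rpow_pos_of_nonneg hε hpos.le
    obtain ⟨s, hs⟩ := ((ENNReal.tendsto_tsum_compl_atTop_zero hfin).eventually
      (Iic_mem_nhds hε')).exists
    refine ⟨s, fun J hJ => ?_⟩
    rw [lpSize_le_iff hp1 hp]
    refine le_trans ?_ hs
    have h2 : ∀ n, (J : Set ℕ).indicator w n ^ p.toReal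
        = (J : Set ℕ).indicator (fun n => w n ^ p.toReal) n := fun n => by
      by_cases hn : n ∈ (J : Set ℕ) <;> simp [hn, hpos]
    simp_rw [h2]
    rw [← tsum_subtype]
    exact ENNReal.tsum_mono_subtype (t := {n | n ∉ s}) (fun n => w n ^ p.toReal)
      fun n hn hns => Finset.disjoint_left.1 hJ hn hns

end lpSize

/-! ### The positive cone of the dual -/

section Dual

variable {X : Type*} [NormedAddCommGroup X] [NormedSpace ℝ X] [Lattice X] [IsOrderedAddMonoid X]

lemma dual_nonneg_iff {f : StrongDual ℝ X} : 0 ≤ f ↔ ∀ x : X, 0 ≤ x → 0 ≤ f x := Iff.rfl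

lemma dual_nonneg_smul {f : StrongDual ℝ X} (hf : 0 ≤ f) {c : ℝ} (hc : 0 ≤ c) : 0 ≤ c • f :=
  dual_nonneg_iff.2 fun x hx => mul_nonneg hc (dual_nonneg_iff.1 hf x hx)

variable [IsOrderedModule ℝ X]

omit [IsOrderedAddMonoid X] in
lemma posPart_smul_of_pos {c : ℝ} (hc : 0 < c) (x : X) : (c • x)⁺ = c • x⁺ := by
  have h : c • (x ⊔ 0) = c • x ⊔ c • (0 : X) := (OrderIso.smulRight hc).map_sup x 0
  rw [posPart_def, posPart_def, h, smul_zero]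

variable [HasSolidNorm X]

/-- Every functional on a normed lattice is the difference of two positive functionals of no larger
norm. -/
lemma exists_nonneg_sub (y : StrongDual ℝ X) :
    ∃ a b : StrongDual ℝ X, 0 ≤ a ∧ 0 ≤ b ∧ ‖a‖ ≤ ‖y‖ ∧ ‖b‖ ≤ ‖y‖ ∧ y = a - b := by
  -- Hahn–Banach on X × X: the functional (x, x) ↦ y(x) on the diagonal is dominated by the
  -- sublinear `N`, because x⁺ + (-x)⁺ = |x|. For an extension g, take a(x) = g(x, 0) and b(x) =
  -- g(0, -x). Both are dominated by ‖y‖ ‖x⁺‖, which yields the norm bound and, evaluated at -x for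
  -- x ≥ 0, positivity.
  let D : Submodule ℝ (X × X) := LinearMap.range ((LinearMap.id (R := ℝ) (M := X)).prod LinearMap.id)
  let F : (X × X) →ₗ.[ℝ] ℝ := ⟨D, (y.toLinearMap ∘ₗ LinearMap.fst ℝ X X) ∘ₗ D.subtype⟩
  let N : X × X → ℝ := fun z => ‖y‖ * ‖z.1⁺ + (-z.2)⁺‖
  have hmono : ∀ {a b : X}, 0 ≤ a → a ≤ b → ‖a‖ ≤ ‖b‖ := fun {a b} ha hab =>
    norm_le_norm_of_abs_le_abs (by rwa [abs_of_nonneg ha, abs_of_nonneg (ha.trans hab)])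
  have hadd : ∀ a b : X, (a + b)⁺ ≤ a⁺ + b⁺ := fun a b =>
    sup_le (add_le_add (le_posPart a) (le_posPart b))
      (add_nonneg (posPart_nonneg a) (posPart_nonneg b))
  obtain ⟨g, hgF, hgN⟩ := exists_extension_of_le_sublinear F N
    (fun c hc z => by
      have h1 : (-(c • z.2))⁺ = c • (-z.2)⁺ := by rw [← smul_neg, posPart_smul_of_pos hc]
      simp only [N, Prod.smul_fst, Prod.smul_snd, h1, posPart_smul_of_pos hc, ← smul_add,
        norm_smul, Real.norm_of_nonneg hc.le]
      ring)
    (fun z w => by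
      simp only [N, ← mul_add]
      gcongr
      refine (hmono (add_nonneg (posPart_nonneg _) (posPart_nonneg _)) ?_).trans
        (norm_add_le _ _)
      have h2 := hadd (-z.2) (-w.2)
      rw [← neg_add] at h2
      calc _ ≤ (z.1⁺ + w.1⁺) + ((-z.2)⁺ + (-w.2)⁺) := add_le_add (hadd _ _) h2
        _ = _ := by abel)
    (fun ⟨z, hz⟩ => by
      obtain ⟨x, rfl⟩ := hz
      have h3 : x⁺ + (-x)⁺ = |x| := by rw [posPart_neg, posPart_add_negPart]
      change y x ≤ ‖y‖ * ‖x⁺ + (-x)⁺‖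
      rw [h3, norm_abs_eq_norm]
      exact (le_abs_self _).trans (y.le_opNorm x))
  have hpos : ∀ x : X, ‖x⁺‖ ≤ ‖x‖ := fun x => norm_le_norm_of_abs_le_abs (by
    rw [abs_of_nonneg (posPart_nonneg x)]; exact sup_le (le_abs_self x) (abs_nonneg x))
  have hA : ∀ x, g (x, 0) ≤ ‖y‖ * ‖x⁺‖ := fun x => by
    have := hgN (x, 0); simpa [N] using this
  have hB : ∀ x, g (0, -x) ≤ ‖y‖ * ‖x⁺‖ := fun x => by
    have := hgN (0, -x); simpa [N] using this
  have hbd : ∀ h : X →ₗ[ℝ] ℝ, (∀ x, h x ≤ ‖y‖ * ‖x⁺‖) → ∀ x, ‖h x‖ ≤ ‖y‖ * ‖x‖ := fun h hh x => by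
    have h1 : h x ≤ ‖y‖ * ‖x‖ := (hh x).trans (by gcongr; exact hpos x)
    have h2 : h (-x) ≤ ‖y‖ * ‖x‖ := (hh (-x)).trans (by gcongr; simpa using hpos (-x))
    rw [map_neg] at h2
    exact abs_le.2 ⟨by linarith, h1⟩
  have hnn : ∀ h : X →ₗ[ℝ] ℝ, (∀ x, h x ≤ ‖y‖ * ‖x⁺‖) → ∀ x, 0 ≤ x → 0 ≤ h x := fun h hh x hx => by
    have h2 := hh (-x)
    rw [posPart_neg, negPart_of_nonneg hx, norm_zero, mul_zero, map_neg] at h2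
    linarith
  let a₀ : X →ₗ[ℝ] ℝ := g ∘ₗ LinearMap.inl ℝ X X
  let b₀ : X →ₗ[ℝ] ℝ := g ∘ₗ LinearMap.inr ℝ X X ∘ₗ (-LinearMap.id)
  refine ⟨a₀.mkContinuous ‖y‖ (hbd a₀ hA), b₀.mkContinuous ‖y‖ (hbd b₀ hB),
    hnn a₀ hA, hnn b₀ hB, a₀.mkContinuous_norm_le (norm_nonneg _) _,
    b₀.mkContinuous_norm_le (norm_nonneg _) _, ?_⟩
  ext x
  have h4 : g (x, x) = y x := hgF ⟨(x, x), ⟨x, rfl⟩⟩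
  have h5 : g (x, x) = g (x, 0) - g (0, -x) := by
    rw [← map_sub]; simp
  change y x = g (x, 0) - g (0, -x)
  rw [← h4, h5]

end Dual

/-! ### Weak norms -/

section WeakNorm

variable {F G : Type*} [NormedAddCommGroup F] [NormedSpace ℝ F]
  [NormedAddCommGroup G] [NormedSpace ℝ G] {p : ℝ≥0∞}

lemma strongNorm_le_weakNorm (y : ℕ → F) {φ : StrongDual ℝ F} (hφ : ‖φ‖ ≤ 1) :
    strongNorm p (fun n => φ (y n)) ≤ weakNorm p y :=
  le_iSup₂ (f := fun (φ : StrongDual ℝ F) (_ : ‖φ‖ ≤ 1) => strongNorm p fun n => φ (y n)) φ hφ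

lemma weakNorm_le_iff {y : ℕ → F} {c : ℝ≥0∞} :
    weakNorm p y ≤ c ↔ ∀ φ : StrongDual ℝ F, ‖φ‖ ≤ 1 → strongNorm p (fun n => φ (y n)) ≤ c :=
  iSup₂_le_iff

lemma strongNorm_smul (hp1 : 1 ≤ p) (c : ℝ) (u : ℕ → F) :
    strongNorm p (fun n => c • u n) = ‖c‖ₑ * strongNorm p u := by
  simp_rw [strongNorm_eq_lpSize, enorm_smul, lpSize_const_mul hp1]

lemma weakNorm_smul_le (hp1 : 1 ≤ p) (c : ℝ) (y : ℕ → F) :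
    weakNorm p (fun n => c • y n) ≤ ‖c‖ₑ * weakNorm p y := by
  refine weakNorm_le_iff.2 fun φ hφ => ?_
  simp_rw [map_smul]
  rw [strongNorm_smul hp1]
  gcongr
  exact strongNorm_le_weakNorm y hφ

lemma weakNorm_map_le (R : F →L[ℝ] G) (hR : ‖R‖ ≤ 1) (y : ℕ → F) :
    weakNorm p (fun n => R (y n)) ≤ weakNorm p y := by
  refine weakNorm_le_iff.2 fun φ hφ => ?_
  refine strongNorm_le_weakNorm y (φ := φ.comp R) ?_
  exact (φ.opNorm_comp_le R).trans (mul_le_one₀ hφ (norm_nonneg _) hR)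

omit [NormedSpace ℝ F] in
lemma strongNorm_prod_le (hp1 : 1 ≤ p) (u : ℕ → ℕ → F) :
    strongNorm p (fun n => u (Nat.unpair n).1 (Nat.unpair n).2) ≤ ∑' k, strongNorm p (u k) := by
  have := lpSize_prod_le hp1 (fun z : ℕ × ℕ => ‖u z.1 z.2‖ₑ)
  rw [← lpSize_equiv Nat.pairEquiv.symm] at this
  exact this

lemma weakNorm_prod_le (hp1 : 1 ≤ p) (y : ℕ → ℕ → F) :
    weakNorm p (fun n => y (Nat.unpair n).1 (Nat.unpair n).2) ≤ ∑' k, weakNorm p (y k) :=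
  weakNorm_le_iff.2 fun φ hφ => (strongNorm_prod_le hp1 fun k n => φ (y k n)).trans
    (ENNReal.tsum_le_tsum fun k => strongNorm_le_weakNorm (y k) hφ)

/-- The convex combination of two sequences, laid out along `ℕ ≃ ℕ ⊕ ℕ`. -/
noncomputable def concat (p : ℝ≥0∞) (s t : ℝ) (u v : ℕ → F) : ℕ → F := fun n =>
  Sum.elim (fun k => (s ^ (p⁻¹).toReal) • u k) (fun k => (t ^ (p⁻¹).toReal) • v k)
    (Equiv.natSumNatEquivNat.symm n)

lemma strongNorm_concat_le_one (hp1 : 1 ≤ p) {s t : ℝ} (hs : 0 ≤ s) (ht : 0 ≤ t)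
    (hst : s + t = 1) {u v : ℕ → F} (hu : strongNorm p u ≤ 1) (hv : strongNorm p v ≤ 1) :
    strongNorm p (concat p s t u v) ≤ 1 := by
  have h := lpSize_sum_le_one hp1 hs ht hst (v := fun n => ‖u n‖ₑ) (w := fun n => ‖v n‖ₑ) hu hv
  rw [← lpSize_equiv Equiv.natSumNatEquivNat.symm] at h
  convert h using 1
  rw [strongNorm_eq_lpSize]
  congr 1
  ext n
  simp only [concat, Function.comp]
  rcases Equiv.natSumNatEquivNat.symm n with k | k <;>
  simp only [Sum.elim_inl, Sum.elim_inr, enorm_smul] <;> congr 1 <;>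
  exact Real.enorm_of_nonneg (by positivity)

lemma map_concat (φ : StrongDual ℝ F) (s t : ℝ) (u v : ℕ → F) (n : ℕ) :
    φ (concat p s t u v n) = concat p s t (fun k => φ (u k)) (fun k => φ (v k)) n := by
  simp only [concat]
  rcases Equiv.natSumNatEquivNat.symm n with k | k <;> simp

lemma weakNorm_concat_le_one (hp1 : 1 ≤ p) {s t : ℝ} (hs : 0 ≤ s) (ht : 0 ≤ t)
    (hst : s + t = 1) {u v : ℕ → F} (hu : weakNorm p u ≤ 1) (hv : weakNorm p v ≤ 1) :
    weakNorm p (concat p s t u v) ≤ 1 :=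
  weakNorm_le_iff.2 fun φ hφ => by
    simp_rw [map_concat]
    exact strongNorm_concat_le_one hp1 hs ht hst (weakNorm_le_iff.1 hu φ hφ)
      (weakNorm_le_iff.1 hv φ hφ)

end WeakNorm

/-! ### The tensor product `X^* ⊗ E` with the positive `p`-nuclear seminorm -/

section PosTensor

open scoped TensorProduct Pointwise

variable (p q : ℝ≥0∞) [hpq : ENNReal.HolderConjugate p q]
variable (X E : Type*) [NormedAddCommGroup X] [NormedSpace ℝ X] [Lattice X]
  [IsOrderedAddMonoid X] [NormedAddCommGroup E] [NormedSpace ℝ E]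

/-- Finite sums `∑ a_j ⊗ u_j` with `a_j ≥ 0`, `‖(a_j)‖_q^w ≤ 1` and `‖(u_j)‖_p ≤ 1`. -/
def posAtoms : Set (StrongDual ℝ X ⊗[ℝ] E) :=
  {t | ∃ (s : Finset ℕ) (a : ℕ → StrongDual ℝ X) (u : ℕ → E), (∀ j, 0 ≤ a j) ∧
    weakNorm q a ≤ 1 ∧ strongNorm p u ≤ 1 ∧ (∀ j ∉ s, u j = 0) ∧ t = ∑ j ∈ s, a j ⊗ₜ u j}

lemma balanced_posAtoms : Balanced ℝ (posAtoms p q X E) := by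
  have hp1 : 1 ≤ p := ENNReal.HolderConjugate.one_le p q
  rintro c hc _ ⟨_, ⟨s, a, u, ha, haw, hu, hus, rfl⟩, rfl⟩
  refine ⟨s, a, fun j => c • u j, ha, haw, ?_, fun j hj => by simp [hus j hj], ?_⟩
  · rw [strongNorm_smul hp1]
    have h1 : ‖c‖ₑ ≤ 1 := by
      rw [← ofReal_norm]; simpa using hc
    exact mul_le_one' h1 hu
  · simp [Finset.smul_sum]

/-- Concatenating two representations with weights c^(1/q) on the functionals and c^(1/p) on the
vectors (likewise for d) keeps both norms at most 1. The weights multiply back to c and d because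
1/p + 1/q = 1. -/
lemma convex_posAtoms : Convex ℝ (posAtoms p q X E) := by
  have hp1 : 1 ≤ p := ENNReal.HolderConjugate.one_le p q
  have hq1 : 1 ≤ q := ENNReal.HolderConjugate.one_le q p
  rintro _ ⟨s, a, u, ha, haw, hu, hus, rfl⟩ _ ⟨s', a', u', ha', haw', hu', hus', rfl⟩
    c d hc hd hcd
  have hprod : ∀ r : ℝ, 0 ≤ r → r ^ (q⁻¹).toReal * r ^ (p⁻¹).toReal = r := fun r hr => by
    rw [← Real.rpow_add_of_nonneg hr ENNReal.toReal_nonneg ENNReal.toReal_nonneg,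
      ← ENNReal.toReal_add (by simp; exact (zero_lt_one.trans_le hq1).ne')
        (by simp; exact (zero_lt_one.trans_le hp1).ne'),
      add_comm, ENNReal.holderConjugate_iff.1 hpq, ENNReal.toReal_one, Real.rpow_one]
  refine ⟨(s.disjSum s').map Equiv.natSumNatEquivNat.toEmbedding, concat q c d a a',
    concat p c d u u', ?_, weakNorm_concat_le_one hq1 hc hd hcd haw haw',
    strongNorm_concat_le_one hp1 hc hd hcd hu hu', ?_, ?_⟩
  · intro j
    simp only [concat]
    rcases Equiv.natSumNatEquivNat.symm j with k | k
    · exact dual_nonneg_smul (ha k) (by positivity)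
    · exact dual_nonneg_smul (ha' k) (by positivity)
  · intro j hj
    obtain ⟨k, rfl⟩ := Equiv.natSumNatEquivNat.surjective j
    simp only [Finset.mem_map_equiv, Equiv.symm_apply_apply] at hj
    simp only [concat, Equiv.symm_apply_apply]
    rcases k with k | k
    · simp [hus k (by simpa using hj)]
    · simp [hus' k (by simpa using hj)]
  · rw [Finset.sum_map, Finset.sum_disjSum, Finset.smul_sum, Finset.smul_sum]
    simp only [concat, Equiv.coe_toEmbedding, Equiv.symm_apply_apply, Sum.elim_inl,
      Sum.elim_inr, TensorProduct.smul_tmul_smul, hprod c hc, hprod d hd]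

variable {X E} in
lemma tmul_mem_smul_posAtoms {a : StrongDual ℝ X} (ha : 0 ≤ a) (u : E) {α β : ℝ} (hα : 0 < α)
    (hβ : 0 < β) (haα : ‖a‖ ≤ α) (huβ : ‖u‖ ≤ β) :
    a ⊗ₜ[ℝ] u ∈ (α * β) • posAtoms p q X E := by
  have hp1 : 1 ≤ p := ENNReal.HolderConjugate.one_le p q
  have hq1 : 1 ≤ q := ENNReal.HolderConjugate.one_le q p
  refine Set.mem_smul_set.2 ⟨(α⁻¹ • a) ⊗ₜ (β⁻¹ • u),
    ⟨{0}, fun j => if j = 0 then α⁻¹ • a else 0, fun j => if j = 0 then β⁻¹ • u else 0,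
      ?_, ?_, ?_, ?_, ?_⟩, ?_⟩
  · intro j
    dsimp only
    split_ifs
    · exact dual_nonneg_smul ha (by positivity)
    · exact le_rfl
  · refine weakNorm_le_iff.2 fun φ hφ => ?_
    refine (lpSize_le_of_single hq1 0 fun n hn => by simp [hn]).trans ?_
    simp only [if_true]
    rw [← ofReal_norm, ENNReal.ofReal_le_one]
    refine (φ.le_opNorm _).trans (mul_le_one₀ hφ (norm_nonneg _) ?_)
    rw [norm_smul, norm_inv, Real.norm_of_nonneg hα.le]
    exact inv_mul_le_one_of_le₀ haα hα.le
  · refine (lpSize_le_of_single hp1 0 fun n hn => by simp [hn]).trans ?_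
    simp only [if_true]
    rw [← ofReal_norm, ENNReal.ofReal_le_one,
      norm_smul, norm_inv, Real.norm_of_nonneg hβ.le]
    exact inv_mul_le_one_of_le₀ huβ hβ.le
  · intro j hj
    simp only [Finset.mem_singleton] at hj
    simp [hj]
  · simp
  · rw [TensorProduct.smul_tmul_smul, smul_smul]
    rw [show α * β * (α⁻¹ * β⁻¹) = 1 by field_simp, one_smul]

variable [IsOrderedModule ℝ X] [HasSolidNorm X]

-- The factor 2 pays for splitting y into two positive functionals of no larger norm; the minus sign
-- is moved onto u. It only serves to make the atoms absorbing and y ⊗ u continuous, so it does not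
-- enter the final constants.
variable {X E} in
lemma tmul_mem_smul_posAtoms' (y : StrongDual ℝ X) (u : E) {α β : ℝ} (hα : 0 < α)
    (hβ : 0 < β) (hy : ‖y‖ ≤ α) (hu : ‖u‖ ≤ β) :
    y ⊗ₜ[ℝ] u ∈ (2 * (α * β)) • posAtoms p q X E := by
  obtain ⟨a, b, ha, hb, han, hbn, rfl⟩ := exists_nonneg_sub y
  have h1 := tmul_mem_smul_posAtoms p q ha u hα hβ (han.trans hy) hu
  have h2 := tmul_mem_smul_posAtoms p q hb (-u) hα hβ (hbn.trans hy) (by rwa [norm_neg])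
  rw [two_mul, (convex_posAtoms p q X E).add_smul (by positivity) (by positivity)]
  convert Set.add_mem_add h1 h2 using 1
  rw [TensorProduct.sub_tmul, TensorProduct.tmul_neg, sub_eq_add_neg]

lemma absorbent_posAtoms : Absorbent ℝ (posAtoms p q X E) := by
  have key : ∀ t : StrongDual ℝ X ⊗[ℝ] E, ∃ r : ℝ, 0 < r ∧ t ∈ r • posAtoms p q X E := by
    intro t
    induction t with
    | zero => exact ⟨1, one_pos, by
        simpa using tmul_mem_smul_posAtoms p q (le_refl (0 : StrongDual ℝ X)) (0 : E) one_pos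
          one_pos (by simp) (by simp)⟩
    | tmul y u => exact ⟨_, by positivity, tmul_mem_smul_posAtoms' p q y u
        (α := ‖y‖ + 1) (β := ‖u‖ + 1) (by positivity) (by positivity) (by simp) (by simp)⟩
    | add t t' h h' =>
      obtain ⟨r, hr, ht⟩ := h
      obtain ⟨r', hr', ht'⟩ := h'
      refine ⟨r + r', by positivity, ?_⟩
      rw [(convex_posAtoms p q X E).add_smul hr.le hr'.le]
      exact Set.add_mem_add ht ht'
  intro t
  obtain ⟨r, hr, ht⟩ := key t
  refine Absorbs.of_norm ⟨r, fun c hc => ?_⟩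
  rw [Set.singleton_subset_iff]
  refine (balanced_posAtoms p q X E).smul_mono (a := r) (b := c) ?_ ht
  rwa [Real.norm_of_nonneg hr.le]

/-- The algebraic tensor product `X^* ⊗ E`, endowed with the positive `p`-nuclear seminorm. -/
def PosTensor (_p _q : ℝ≥0∞) (X E : Type*) [NormedAddCommGroup X] [NormedSpace ℝ X]
    [NormedAddCommGroup E] [NormedSpace ℝ E] : Type _ := StrongDual ℝ X ⊗[ℝ] E

noncomputable instance : AddCommGroup (PosTensor p q X E) :=
  inferInstanceAs (AddCommGroup (StrongDual ℝ X ⊗[ℝ] E))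

noncomputable instance : Module ℝ (PosTensor p q X E) :=
  inferInstanceAs (Module ℝ (StrongDual ℝ X ⊗[ℝ] E))

/-- The gauge of `posAtoms`. -/
noncomputable def posTensorSeminorm : Seminorm ℝ (PosTensor p q X E) :=
  gaugeSeminorm (balanced_posAtoms p q X E) (convex_posAtoms p q X E) (absorbent_posAtoms p q X E)

noncomputable instance : SeminormedAddCommGroup (PosTensor p q X E) :=
  (posTensorSeminorm p q X E).toAddGroupSeminorm.toSeminormedAddCommGroup

noncomputable instance : NormedSpace ℝ (PosTensor p q X E) where
  norm_smul_le c t := (map_smul_eq_mul (posTensorSeminorm p q X E) c t).le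

lemma posTensor_norm_def (t : PosTensor p q X E) : ‖t‖ = gauge (posAtoms p q X E) t := rfl

variable {X E}

/-- The bilinear map `(y, u) ↦ y ⊗ u`. -/
noncomputable def posTmul : StrongDual ℝ X →L[ℝ] E →L[ℝ] PosTensor p q X E :=
  LinearMap.mkContinuous₂ (TensorProduct.mk ℝ (StrongDual ℝ X) E) 2 fun y u => by
    change gauge (posAtoms p q X E) (y ⊗ₜ u) ≤ _
    have h : ∀ ε : ℝ, 0 < ε → gauge (posAtoms p q X E) (y ⊗ₜ u) ≤
        2 * ((‖y‖ + ε) * (‖u‖ + ε)) := fun ε hε =>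
      gauge_le_of_mem (by positivity) (tmul_mem_smul_posAtoms' p q y u
        (by positivity) (by positivity) (by linarith) (by linarith))
    have hc : Tendsto (fun ε : ℝ => 2 * ((‖y‖ + ε) * (‖u‖ + ε))) (𝓝[>] 0)
        (𝓝 (2 * ((‖y‖ + 0) * (‖u‖ + 0)))) :=
      Tendsto.mono_left (Continuous.tendsto (by fun_prop) 0) nhdsWithin_le_nhds
    have := ge_of_tendsto hc (eventually_mem_nhdsWithin.mono h)
    simpa [mul_assoc] using this

/-- The seminorm of a finite sum `∑ a_j ⊗ u_j` with `a_j ≥ 0`. -/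
lemma norm_sum_posTmul_le {a : ℕ → StrongDual ℝ X} (ha : ∀ j, 0 ≤ a j) {u : ℕ → E} {s : Finset ℕ}
    {α β : ℝ} (hα : 0 < α) (hβ : 0 < β) (haα : weakNorm q a ≤ ENNReal.ofReal α)
    (hu : strongNorm p ((s : Set ℕ).indicator u) ≤ ENNReal.ofReal β) :
    ‖∑ j ∈ s, posTmul p q (a j) (u j)‖ ≤ α * β := by
  have hp1 : 1 ≤ p := ENNReal.HolderConjugate.one_le p q
  have hq1 : 1 ≤ q := ENNReal.HolderConjugate.one_le q p
  have hinv : ∀ r : ℝ, 0 < r → ∀ c ≤ ENNReal.ofReal r, ‖r⁻¹‖ₑ * c ≤ 1 := fun r hr c hc => by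
    rw [Real.enorm_of_nonneg (by positivity)]
    refine (mul_le_mul_right hc _).trans ?_
    rw [← ENNReal.ofReal_mul (by positivity), inv_mul_cancel₀ hr.ne', ENNReal.ofReal_one]
  rw [posTensor_norm_def]
  refine gauge_le_of_mem (by positivity) (Set.mem_smul_set.2
    ⟨∑ j ∈ s, (α⁻¹ • a j) ⊗ₜ (β⁻¹ • (s : Set ℕ).indicator u j),
    ⟨s, fun j => α⁻¹ • a j, fun j => β⁻¹ • (s : Set ℕ).indicator u j,
      fun j => dual_nonneg_smul (ha j) (by positivity),
      (weakNorm_smul_le hq1 _ _).trans (hinv α hα _ haα), ?_, ?_, rfl⟩, ?_⟩)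
  · rw [strongNorm_smul hp1]
    exact hinv β hβ _ hu
  · intro j hj
    simp [hj]
  · rw [Finset.smul_sum]
    refine Finset.sum_congr rfl fun j hj => ?_
    rw [Set.indicator_of_mem (by exact_mod_cast hj), TensorProduct.smul_tmul_smul, smul_smul,
      show α * β * (α⁻¹ * β⁻¹) = 1 by field_simp, one_smul]
    rfl

/-- A bound on the seminorm controls only a product, but scalars move freely across the tensor sign,
so the two factors can be prescribed separately. The block construction needs this, since both norms
must be summed over blocks. -/
lemma exists_rep_of_norm_lt {t : PosTensor p q X E} {α β : ℝ} (hα : 0 < α)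
    (ht : ‖t‖ < α * β) :
    ∃ (s : Finset ℕ) (a : ℕ → StrongDual ℝ X) (u : ℕ → E), (∀ j, 0 ≤ a j) ∧
      weakNorm q a ≤ ENNReal.ofReal α ∧ strongNorm p u ≤ ENNReal.ofReal β ∧
      (∀ j ∉ s, u j = 0) ∧ t = ∑ j ∈ s, posTmul p q (a j) (u j) := by
  have hp1 : 1 ≤ p := ENNReal.HolderConjugate.one_le p q
  have hq1 : 1 ≤ q := ENNReal.HolderConjugate.one_le q p
  obtain ⟨b, hb0, hb, _, ⟨s, a, u, ha, haw, hu, hus, rfl⟩, rfl⟩ :=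
    exists_lt_of_gauge_lt (absorbent_posAtoms p q X E) ht
  refine ⟨s, fun j => α • a j, fun j => (b / α) • u j,
    fun j => dual_nonneg_smul (ha j) hα.le, ?_, ?_, fun j hj => by simp [hus j hj], ?_⟩
  · refine (weakNorm_smul_le hq1 _ _).trans ?_
    rw [Real.enorm_of_nonneg hα.le]
    exact mul_le_of_le_one_right' haw
  · rw [strongNorm_smul hp1, Real.enorm_of_nonneg (by positivity)]
    refine (mul_le_of_le_one_right' hu).trans (ENNReal.ofReal_le_ofReal ?_)
    rw [div_le_iff₀ hα, mul_comm]; exact hb.le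
  · change b • ∑ j ∈ s, a j ⊗ₜ[ℝ] u j = ∑ j ∈ s, (α • a j) ⊗ₜ[ℝ] ((b / α) • u j)
    rw [Finset.smul_sum]
    refine Finset.sum_congr rfl fun j _ => ?_
    rw [TensorProduct.smul_tmul_smul, mul_div_cancel₀ b hα.ne']

/-- The operator `X → E` induced by a tensor. -/
noncomputable def posTensorOpₗ : PosTensor p q X E →ₗ[ℝ] (X →L[ℝ] E) :=
  TensorProduct.lift (LinearMap.mk₂ ℝ (fun (y : StrongDual ℝ X) (u : E) => y.smulRight u)
    (fun y y' u => by ext; simp [add_smul]) (fun c y u => by ext; simp [mul_smul])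
    (fun y u u' => by ext; simp) (fun c y u => by ext x; exact smul_comm (y x) c u))

lemma posTensorOpₗ_posTmul (y : StrongDual ℝ X) (u : E) :
    posTensorOpₗ p q (posTmul p q y u) = y.smulRight u :=
  TensorProduct.lift.tmul _ _

omit [Lattice X] [IsOrderedAddMonoid X] [IsOrderedModule ℝ X] [HasSolidNorm X] in
/-- Hölder's inequality for the sum `∑ a_j ⊗ u_j`. -/
lemma norm_sum_smulRight_le {a : ℕ → StrongDual ℝ X} {u : ℕ → E} (s : Finset ℕ)
    (ha : weakNorm q a ≤ 1) (hu : strongNorm p u ≤ 1) :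
    ‖∑ j ∈ s, (a j).smulRight (u j)‖ ≤ 1 := by
  refine ContinuousLinearMap.opNorm_le_of_unit_norm zero_le_one fun x hx => ?_
  -- The weak norm of `a` is tested against evaluation at x, a functional in the unit ball of
  -- X^{**}.
  have hx' : ‖NormedSpace.inclusionInDoubleDual ℝ X x‖ ≤ 1 :=
    (NormedSpace.double_dual_bound ℝ X x).trans hx.le
  have h1 := weakNorm_le_iff.1 ha _ hx'
  rw [← ENNReal.ofReal_le_one, ofReal_norm]
  have h0 : (∑ j ∈ s, (a j).smulRight (u j)) x = ∑ j ∈ s, a j x • u j := by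
    simp
  rw [h0]
  calc ‖∑ j ∈ s, a j x • u j‖ₑ ≤ ∑ j ∈ s, ‖a j x • u j‖ₑ := enorm_sum_le _ _
    _ ≤ ∑' j, ‖a j x‖ₑ * ‖u j‖ₑ := by
        simp_rw [enorm_smul]
        exact ENNReal.sum_le_tsum s
    _ ≤ lpSize q (fun j => ‖a j x‖ₑ) * lpSize p (fun j => ‖u j‖ₑ) :=
        tsum_mul_le_lpSize_mul_lpSize q p _ _
    _ ≤ 1 := mul_le_one' h1 hu

/-- The contraction `X^* ⊗ E → L(X, E)`. -/
noncomputable def posTensorOp : PosTensor p q X E →L[ℝ] (X →L[ℝ] E) :=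
  (posTensorOpₗ p q).mkContinuous 1 fun t => by
    rw [one_mul]
    refine le_of_forall_gt_imp_ge_of_dense fun r hr => ?_
    have hr0 : 0 < r := (norm_nonneg t).trans_lt hr
    obtain ⟨s, a, u, ha, haw, hu, -, ht⟩ := exists_rep_of_norm_lt p q one_pos
      (by rwa [one_mul] : ‖t‖ < 1 * r)
    have h1 := norm_sum_smulRight_le p q (u := fun j => r⁻¹ • u j) s (by simpa using haw) (by
      rw [strongNorm_smul (ENNReal.HolderConjugate.one_le p q),
        Real.enorm_of_nonneg (by positivity)]
      refine (mul_le_mul_right hu _).trans ?_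
      rw [← ENNReal.ofReal_mul (by positivity), inv_mul_cancel₀ hr0.ne', ENNReal.ofReal_one])
    have h2 : posTensorOpₗ p q t = r • ∑ j ∈ s, (a j).smulRight (r⁻¹ • u j) := by
      rw [ht, map_sum, Finset.smul_sum]
      refine Finset.sum_congr rfl fun j _ => ?_
      rw [posTensorOpₗ_posTmul]
      ext x
      simp only [ContinuousLinearMap.smulRight_apply, smul_apply, smul_smul]
      congr 1
      field_simp
    rw [h2, norm_smul, Real.norm_of_nonneg hr0.le]
    exact mul_le_of_le_one_right hr0.le h1

lemma posTensorOp_posTmul (y : StrongDual ℝ X) (u : E) :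
    posTensorOp p q (posTmul p q y u) = y.smulRight u :=
  posTensorOpₗ_posTmul p q y u

end PosTensor

/-! ### Second adjoints -/

section Bidual

variable {E V : Type*} [SeminormedAddCommGroup E] [NormedSpace ℝ E]
  [SeminormedAddCommGroup V] [NormedSpace ℝ V]

/-- The map `A ↦ A^{**}`. -/
noncomputable def bidualMap (E V : Type*) [SeminormedAddCommGroup E] [NormedSpace ℝ E]
    [SeminormedAddCommGroup V] [NormedSpace ℝ V] :
    (E →L[ℝ] V) →L[ℝ]
      (StrongDual ℝ (StrongDual ℝ E) →L[ℝ] StrongDual ℝ (StrongDual ℝ V)) :=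
  (ContinuousLinearMap.compL ℝ (StrongDual ℝ V) (StrongDual ℝ E) ℝ).flip ∘L
    (ContinuousLinearMap.compL ℝ E V ℝ).flip

lemma bidualMap_apply (A : E →L[ℝ] V) (g : StrongDual ℝ (StrongDual ℝ E)) (φ : StrongDual ℝ V) :
    bidualMap E V A g φ = g (φ.comp A) := rfl

lemma bidualMap_inclusion (A : E →L[ℝ] V) (u : E) :
    bidualMap E V A (NormedSpace.inclusionInDoubleDual ℝ E u) =
      NormedSpace.inclusionInDoubleDual ℝ V (A u) := rfl

lemma exists_norm_sub_le_apply (ψ : StrongDual ℝ E) {η : ℝ} (hη : 0 < η) :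
    ∃ e : E, ‖e‖ ≤ 1 ∧ ‖ψ‖ - η ≤ ψ e := by
  by_contra! hcon
  have h0 : 0 < ‖ψ‖ - η := by simpa using hcon 0 (by simp)
  have hab : ∀ e : E, ‖e‖ ≤ 1 → ‖ψ e‖ ≤ ‖ψ‖ - η := fun e he => by
    have h1 := hcon (-e) (by rwa [norm_neg])
    rw [map_neg] at h1
    exact abs_le.2 ⟨by linarith, (hcon e he).le⟩
  have h2 : ‖ψ‖ ≤ ‖ψ‖ - η := ψ.opNorm_le_bound h0.le fun x => by
    rcases (norm_nonneg x).eq_or_lt with hx | hx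
    · have := ψ.le_opNorm x
      rw [← hx] at this ⊢
      simpa using this
    · have := hab (‖x‖⁻¹ • x) (by
        rw [norm_smul, norm_inv, norm_norm, inv_mul_cancel₀ hx.ne'])
      rw [map_smul, norm_smul, norm_inv, norm_norm, inv_mul_le_iff₀ hx] at this
      rwa [mul_comm] at this
  linarith

variable {ι : Type*} {s : Finset ι} {A : ι → E →L[ℝ] V} {w : ι → ℝ} {c : ℝ}

/-- Choose e_j in the unit ball almost norming φ ∘ A_j and insert u_j = w_j e_j. Thus a bound
uniform over all u_j dominated by w_j becomes absolute summability on the dual side. -/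
lemma sum_mul_norm_comp_le (hw : ∀ j, 0 ≤ w j)
    (h : ∀ u : ι → E, (∀ j, ‖u j‖ ≤ w j) → ‖∑ j ∈ s, A j (u j)‖ ≤ c) (φ : StrongDual ℝ V) :
    ∑ j ∈ s, w j * ‖φ.comp (A j)‖ ≤ c * ‖φ‖ := by
  have key : ∀ η : ℝ, 0 < η → ∑ j ∈ s, w j * ‖φ.comp (A j)‖ ≤ c * ‖φ‖ + η * ∑ j ∈ s, w j := by
    intro η hη
    choose e he1 he2 using fun j => exists_norm_sub_le_apply (φ.comp (A j)) hη
    have h1 : ∑ j ∈ s, w j * (‖φ.comp (A j)‖ - η) ≤ φ (∑ j ∈ s, A j (w j • e j)) := by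
      rw [map_sum]
      refine Finset.sum_le_sum fun j _ => ?_
      rw [map_smul, map_smul, smul_eq_mul]
      exact mul_le_mul_of_nonneg_left (he2 j) (hw j)
    have h2 : φ (∑ j ∈ s, A j (w j • e j)) ≤ ‖φ‖ * c :=
      (le_abs_self _).trans ((φ.le_opNorm _).trans (mul_le_mul_of_nonneg_left (h _ fun j => by
        rw [norm_smul, Real.norm_of_nonneg (hw j)]
        exact mul_le_of_le_one_right (hw j) (he1 j)) (norm_nonneg _)))
    simp_rw [mul_sub, Finset.sum_sub_distrib, ← Finset.sum_mul] at h1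
    linarith
  have hc : Tendsto (fun η : ℝ => c * ‖φ‖ + η * ∑ j ∈ s, w j) (𝓝[>] 0)
      (𝓝 (c * ‖φ‖ + 0 * ∑ j ∈ s, w j)) :=
    Tendsto.mono_left (Continuous.tendsto (by fun_prop) 0) nhdsWithin_le_nhds
  simpa using ge_of_tendsto hc (eventually_mem_nhdsWithin.mono key)

/-- The hypothesis reproduces itself for the second adjoints, with the same constant, so the duality
estimate can be applied again one level up. -/
lemma norm_sum_bidualMap_le (hw : ∀ j, 0 ≤ w j)
    (h : ∀ u : ι → E, (∀ j, ‖u j‖ ≤ w j) → ‖∑ j ∈ s, A j (u j)‖ ≤ c)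
    (g : ι → StrongDual ℝ (StrongDual ℝ E)) (hg : ∀ j, ‖g j‖ ≤ w j) :
    ‖∑ j ∈ s, bidualMap E V (A j) (g j)‖ ≤ c := by
  have hc : 0 ≤ c := (norm_nonneg _).trans (h (fun _ => 0) fun j => by simpa using hw j)
  refine ContinuousLinearMap.opNorm_le_bound _ hc fun φ => ?_
  refine le_trans ?_ (sum_mul_norm_comp_le hw h φ)
  rw [sum_apply]
  refine (norm_sum_le _ _).trans (Finset.sum_le_sum fun j _ => ?_)
  rw [bidualMap_apply]
  exact ((g j).le_opNorm _).trans (mul_le_mul_of_nonneg_right (hg j) (norm_nonneg _))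

lemma sum_mul_norm_comp_bidualMap_le (hw : ∀ j, 0 ≤ w j)
    (h : ∀ u : ι → E, (∀ j, ‖u j‖ ≤ w j) → ‖∑ j ∈ s, A j (u j)‖ ≤ c)
    (Ψ : StrongDual ℝ (StrongDual ℝ (StrongDual ℝ V))) :
    ∑ j ∈ s, w j * ‖Ψ.comp (bidualMap E V (A j))‖ ≤ c * ‖Ψ‖ :=
  sum_mul_norm_comp_le hw (fun g hg => norm_sum_bidualMap_le hw h g hg) Ψ

end Bidual

/-- A point on which all functionals vanishing on the range of `M` vanish is in the closure of the
range. -/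
lemma exists_norm_sub_lt_of_forall_dual {V W : Type*} [SeminormedAddCommGroup V] [NormedSpace ℝ V]
    [SeminormedAddCommGroup W] [NormedSpace ℝ W] (M : V →L[ℝ] W) (z : W)
    (h : ∀ Ψ : StrongDual ℝ W, (∀ t, Ψ (M t) = 0) → Ψ z = 0) {δ : ℝ} (hδ : 0 < δ) :
    ∃ t, ‖z - M t‖ < δ := by
  let S : Submodule ℝ W := (LinearMap.range (M : V →ₗ[ℝ] W)).topologicalClosure
  have hz : z ∈ S := by
    by_contra hz
    obtain ⟨Ψ, r, hr, hrz⟩ := geometric_hahn_banach_closed_point S.convex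
      (Submodule.isClosed_topologicalClosure _) hz
    have h0 : 0 < r := by simpa using hr 0 S.zero_mem
    have hv : ∀ t, Ψ (M t) = 0 := by
      intro t
      by_contra hne
      -- If Ψ were nonzero on the range, this multiple would attain the value r, against the strict
      -- bound on the subspace.
      have hmem : M ((r / Ψ (M t)) • t) ∈ S := Submodule.le_topologicalClosure _ ⟨_, rfl⟩
      have := hr _ hmem
      rw [map_smul, map_smul, smul_eq_mul, div_mul_cancel₀ _ hne] at this
      exact lt_irrefl _ this
    rw [h Ψ hv] at hrz
    exact absurd h0 (not_lt.2 hrz.le)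
  obtain ⟨_, ⟨t, rfl⟩, ht⟩ := Metric.mem_closure_iff.1 hz δ hδ
  exact ⟨t, by rwa [dist_eq_norm] at ht⟩

/-! ### Traces -/

section Trace

variable {Y Z : Type*} [NormedAddCommGroup Y] [NormedSpace ℝ Y]
  [NormedAddCommGroup Z] [NormedSpace ℝ Z]

lemma IsFiniteRank.exists_eq_sum {R : Y →L[ℝ] Z} (hR : IsFiniteRank R) :
    ∃ (n : ℕ) (χ : Fin n → StrongDual ℝ Y) (e : Fin n → Z),
      ∀ y, R y = ∑ i, χ i y • e i := by
  have : FiniteDimensional ℝ (LinearMap.range (R : Y →ₗ[ℝ] Z)) := hR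
  let b := Module.finBasis ℝ (LinearMap.range (R : Y →ₗ[ℝ] Z))
  let R' : Y →L[ℝ] LinearMap.range (R : Y →ₗ[ℝ] Z) := R.codRestrict _ fun y => ⟨y, rfl⟩
  refine ⟨_, fun i => (LinearMap.toContinuousLinearMap (b.coord i)).comp R',
    fun i => (b i : Z), fun y => ?_⟩
  have h := congrArg Subtype.val (b.sum_repr (R' y))
  rw [Submodule.coe_sum] at h
  exact h.symm

/-- With R = ∑ χ_i ⊗ e_i a finite sum, ∑_j θ_j(R y_j) = ∑_i χ_i(∑_j θ_j(e_i) y_j). Only a finite sum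
is interchanged, so no absolute convergence is required. -/
lemma IsFiniteRank.hasSum_apply_zero {R : Y →L[ℝ] Z} (hR : IsFiniteRank R)
    {θ : ℕ → StrongDual ℝ Z} {y : ℕ → Y} (h : ∀ e, HasSum (fun j => θ j e • y j) 0) :
    HasSum (fun j => θ j (R (y j))) 0 := by
  obtain ⟨n, χ, e, hRe⟩ := hR.exists_eq_sum
  have h1 : HasSum (fun j => ∑ i, χ i (θ j (e i) • y j)) (∑ i : Fin n, χ i 0) :=
    hasSum_sum fun i _ => (h (e i)).mapL (χ i)
  simp only [map_zero, Finset.sum_const_zero] at h1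
  convert h1 using 2 with j
  rw [hRe, map_sum]
  refine Finset.sum_congr rfl fun i _ => ?_
  rw [map_smul, map_smul, smul_eq_mul, smul_eq_mul, mul_comm]

/-- Take τ_n = √r_n, with r_n the tails of a_n + 2^(-n); the geometric term keeps them positive.
Then (r_n - r_{n+1})/√r_n ≤ 2(√r_n - √r_{n+1}), which telescopes. -/
lemma exists_weights {a : ℕ → ℝ} (ha : ∀ n, 0 ≤ a n) (hs : Summable a) :
    ∃ τ : ℕ → ℝ, (∀ n, 0 < τ n) ∧ Tendsto τ atTop (𝓝 0) ∧ Summable fun n => a n / τ n := by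
  set b : ℕ → ℝ := fun n => a n + (1 / 2) ^ n
  have hb : Summable b := hs.add summable_geometric_two
  have hb0 : ∀ n, 0 < b n := fun n => add_pos_of_nonneg_of_pos (ha n) (by positivity)
  set r : ℕ → ℝ := fun n => ∑' k, b (k + n)
  have hrs : ∀ n, Summable fun k => b (k + n) := fun n => (summable_nat_add_iff n).2 hb
  have hr0 : ∀ n, 0 < r n := fun n => (hrs n).tsum_pos (fun k => (hb0 _).le) 0 (hb0 _)
  have hstep : ∀ n, r n = b n + r (n + 1) := fun n => by
    simp only [r]
    rw [(hrs n).tsum_eq_zero_add, zero_add]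
    congr 2; ext k; congr 1; ring
  refine ⟨fun n => √(r n), fun n => Real.sqrt_pos.2 (hr0 n), ?_, ?_⟩
  · have := (tendsto_sum_nat_add b).sqrt
    rwa [Real.sqrt_zero] at this
  · refine Summable.of_nonneg_of_le (f := fun n => 2 * (√(r n) - √(r (n + 1))))
      (fun n => div_nonneg (ha n) (Real.sqrt_nonneg _)) (fun n => ?_) ?_
    · have h1 := Real.sq_sqrt (hr0 n).le
      have h2 := Real.sq_sqrt (hr0 (n + 1)).le
      have h3 : √(r (n + 1)) ≤ √(r n) := Real.sqrt_le_sqrt (by linarith [hstep n, hb0 n])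
      rw [div_le_iff₀ (Real.sqrt_pos.2 (hr0 n))]
      have h4 : a n ≤ r n - r (n + 1) := by
        have : a n ≤ b n := le_add_of_nonneg_right (by positivity)
        linarith [hstep n]
      nlinarith [Real.sqrt_nonneg (r n), Real.sqrt_nonneg (r (n + 1)),
        sq_nonneg (√(r n) - √(r (n + 1)))]
    · refine summable_of_sum_range_le (c := 2 * √(r 0)) (fun n => ?_) fun n => ?_
      · have h3 : √(r (n + 1)) ≤ √(r n) := Real.sqrt_le_sqrt (by linarith [hstep n, hb0 n])
        linarith
      · rw [← Finset.mul_sum, Finset.sum_range_sub']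
        linarith [Real.sqrt_nonneg (r n)]

/-- The trace of a nuclear representation of the zero operator on a complemented subspace of a space
with the approximation property vanishes. -/
lemma HasAP.tsum_apply_eq_zero (hY : HasAP Y) (Q : Y →L[ℝ] Y) {φ : ℕ → StrongDual ℝ Y} {h : ℕ → Y}
    (hsum : Summable fun j => ‖φ j‖ * ‖h j‖) (hQ : ∀ j, Q (h j) = h j)
    (h0 : ∀ g, HasSum (fun j => φ j (Q g) • h j) 0) : ∑' j, φ j (h j) = 0 := by
  obtain ⟨τ, hτ0, hτ, hτs⟩ := exists_weights (fun j => by positivity) hsum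
  -- The rescaled vectors tend to 0, so together with 0 they form a compact set on which the AP
  -- applies, while the compensating coefficients stay summable against ‖φ_j‖.
  set k : ℕ → Y := fun j => (τ j / ‖h j‖) • h j
  have hk : Tendsto k atTop (𝓝 0) := by
    refine squeeze_zero_norm (fun j => ?_) hτ
    rw [norm_smul, norm_div, norm_norm, Real.norm_of_nonneg (hτ0 j).le]
    rw [div_mul_eq_mul_div]
    exact div_le_of_le_mul₀ (norm_nonneg _) (hτ0 j).le le_rfl
  have hkh : ∀ j, h j = (‖h j‖ / τ j) • k j := fun j => by
    by_cases hj : h j = 0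
    · simp [hj]
    · rw [smul_smul, div_mul_div_cancel₀ (hτ0 j).ne', div_self (norm_ne_zero_iff.2 hj), one_smul]
  set C := ∑' j, ‖φ j‖ * ‖h j‖ / τ j
  have hs : Summable fun j => φ j (h j) :=
    Summable.of_norm_bounded hsum fun j => (φ j).le_opNorm _
  have key : ∀ ε : ℝ, 0 < ε → ‖∑' j, φ j (h j)‖ ≤ ε * (‖Q‖ * C) := by
    intro ε hε
    obtain ⟨R, hR, hRk⟩ := hY ε hε _ hk.isCompact_insert_range
    have h1 : HasSum (fun j => φ j (Q (R (h j)))) 0 :=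
      hR.hasSum_apply_zero (θ := fun j => (φ j).comp Q) h0
    have h2 := hs.hasSum.sub h1
    rw [sub_zero] at h2
    rw [← h2.tsum_eq]
    refine tsum_of_norm_bounded ((hτs.hasSum.mul_left ‖Q‖).mul_left ε) fun j => ?_
    -- Inserting Q in front of h_j, which it fixes, puts the difference in the form Q(h_j - R h_j).
    have h3 : φ j (h j) - φ j (Q (R (h j))) = φ j (Q ((‖h j‖ / τ j) • (k j - R (k j)))) := by
      conv_lhs => rw [← hQ j, ← map_sub, ← map_sub, hQ j]
      rw [smul_sub, ← map_smul, ← hkh]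
    have h4 : ‖k j - R (k j)‖ ≤ ε := by
      rw [norm_sub_rev]; exact (hRk _ (Set.mem_insert_of_mem _ ⟨j, rfl⟩)).le
    rw [h3]
    calc _ ≤ ‖φ j‖ * (‖Q‖ * ((‖h j‖ / τ j) * ε)) := by
          refine (φ j).le_opNorm_of_le (Q.le_opNorm_of_le ?_)
          rw [norm_smul, norm_div, norm_norm, Real.norm_of_nonneg (hτ0 j).le]
          exact mul_le_mul_of_nonneg_left h4 (div_nonneg (norm_nonneg _) (hτ0 j).le)
      _ = _ := by ring
  have hc : Tendsto (fun ε : ℝ => ε * (‖Q‖ * C)) (𝓝[>] 0) (𝓝 (0 * (‖Q‖ * C))) :=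
    Tendsto.mono_left (Continuous.tendsto (by fun_prop) 0) nhdsWithin_le_nhds
  have := ge_of_tendsto hc (eventually_mem_nhdsWithin.mono key)
  rw [zero_mul] at this
  exact norm_le_zero_iff.1 this

/-- The analogue of `HasAP.tsum_apply_eq_zero` for positive contractions of finite rank, under
a uniform bound on tails. -/
lemma HasPMAP.hasSum_apply_eq_zero [PartialOrder Y] (hY : HasPMAP Y) (U : Y →L[ℝ] StrongDual ℝ Z)
    {f : ℕ → Z} {y : ℕ → Y} {t : ℝ} (ht : HasSum (fun j => U (y j) (f j)) t)
    (htail : ∀ ε : ℝ, 0 < ε → ∃ s : Finset ℕ, ∀ R : Y →L[ℝ] Y, IsPositiveOp R → ‖R‖ ≤ 1 →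
      ∀ J : Finset ℕ, Disjoint J s → ∑ j ∈ J, ‖f j‖ * ‖U (R (y j))‖ ≤ ε)
    (h0 : ∀ e, HasSum (fun j => U e (f j) • y j) 0) : t = 0 := by
  have key : ∀ ε : ℝ, 0 < ε → ‖t‖ ≤ 3 * ε := by
    intro ε hε
    obtain ⟨s, hs⟩ := htail ε hε
    set B := ∑ j ∈ s, ‖f j‖
    have hB : 0 ≤ B := Finset.sum_nonneg fun j _ => norm_nonneg _
    -- R need only be close to the identity at the finitely many y_j with j ∈ s; the tails are
    -- controlled by `htail`, once for the identity and once for R. The summand 1 keeps the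
    -- denominator positive.
    obtain ⟨R, hR, hRpos, hR1, hRy⟩ := hY (ε / (‖U‖ * B + 1)) (by positivity)
      (y '' s) (s.finite_toSet.image y).isCompact
    have h1 : HasSum (fun j => U (R (y j)) (f j)) 0 :=
      hR.hasSum_apply_zero (θ := fun j => U.flip (f j)) h0
    have h2 := ht.sub h1
    rw [sub_zero] at h2
    have hterm : ∀ j, ‖U (y j) (f j) - U (R (y j)) (f j)‖ ≤
        ‖f j‖ * ‖U (y j)‖ + ‖f j‖ * ‖U (R (y j))‖ := fun j => by
      refine (norm_sub_le _ _).trans (add_le_add ?_ ?_) <;>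
      · rw [mul_comm]; exact ContinuousLinearMap.le_opNorm _ _
    have hin : ∑ j ∈ s, ‖U (y j) (f j) - U (R (y j)) (f j)‖ ≤ ε := by
      calc _ ≤ ∑ j ∈ s, ‖U‖ * (ε / (‖U‖ * B + 1)) * ‖f j‖ := by
            refine Finset.sum_le_sum fun j hj => ?_
            rw [← sub_apply, ← map_sub]
            refine ContinuousLinearMap.le_of_opNorm_le _ (U.le_opNorm_of_le ?_) _
            rw [norm_sub_rev]; exact (hRy _ ⟨j, hj, rfl⟩).le
        _ = ε * ((‖U‖ * B) / (‖U‖ * B + 1)) := by rw [← Finset.mul_sum]; ring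
        _ ≤ ε := mul_le_of_le_one_right hε.le (div_le_one_of_le₀ (by linarith) (by positivity))
    refine le_of_tendsto h2.norm ((eventually_ge_atTop s).mono fun J hJ => ?_)
    have hd : Disjoint (J \ s) s := Finset.sdiff_disjoint
    have hid := hs (ContinuousLinearMap.id ℝ Y) (fun x hx => hx) ContinuousLinearMap.norm_id_le _ hd
    have hRR := hs R hRpos hR1 _ hd
    calc _ ≤ ∑ j ∈ J, ‖U (y j) (f j) - U (R (y j)) (f j)‖ := norm_sum_le _ _
      _ = ∑ j ∈ J \ s, ‖U (y j) (f j) - U (R (y j)) (f j)‖ +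
          ∑ j ∈ s, ‖U (y j) (f j) - U (R (y j)) (f j)‖ := (Finset.sum_sdiff hJ).symm
      _ ≤ (ε + ε) + ε := by
          refine add_le_add ((Finset.sum_le_sum fun j _ => hterm j).trans ?_) hin
          rw [Finset.sum_add_distrib]
          exact add_le_add hid hRR
      _ = 3 * ε := by ring
  have hc : Tendsto (fun ε : ℝ => 3 * ε) (𝓝[>] 0) (𝓝 (3 * 0)) :=
    Tendsto.mono_left (Continuous.tendsto (by fun_prop) 0) nhdsWithin_le_nhds
  have := ge_of_tendsto hc (eventually_mem_nhdsWithin.mono key)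
  rw [mul_zero] at this
  exact norm_le_zero_iff.1 this

end Trace

/-! ### The tensor of the adjoint in the bidual of `X^* ⊗ E` -/

section Closure

variable (p q : ℝ≥0∞) [hpq : ENNReal.HolderConjugate p q]
variable {X E : Type*} [NormedAddCommGroup X] [NormedSpace ℝ X] [Lattice X]
  [IsOrderedAddMonoid X] [IsOrderedModule ℝ X] [HasSolidNorm X]
  [NormedAddCommGroup E] [NormedSpace ℝ E]

omit [NormedSpace ℝ E] in
lemma exists_finset_strongNorm_indicator_le (hp1 : 1 ≤ p) {f : ℕ → E} (hf : IsPSummable p f)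
    {ε : ℝ} (hε : 0 < ε) : ∃ s : Finset ℕ, ∀ J : Finset ℕ, Disjoint J s →
      strongNorm p ((J : Set ℕ).indicator f) ≤ ENNReal.ofReal ε := by
  obtain ⟨s, hs⟩ := exists_finset_lpSize_indicator_le hp1 (w := fun n => ‖f n‖ₑ) hf.1
    (fun h => by simpa using (hf.2 h).enorm) (ENNReal.ofReal_pos.2 hε)
  refine ⟨s, fun J hJ => ?_⟩
  rw [strongNorm_eq_lpSize]
  simpa only [enorm_indicator_eq_indicator_enorm] using hs J hJ

omit [NormedSpace ℝ E] in
lemma strongNorm_indicator_le (f : ℕ → E) (J : Set ℕ) :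
    strongNorm p (J.indicator f) ≤ strongNorm p f := by
  refine lpSize_mono fun n => ?_
  by_cases hn : n ∈ J <;> simp [hn]

/-- The bound of `norm_sum_posTmul_le` for vectors `u_j` dominated in norm by `f_j`. -/
lemma norm_sum_posTmul_le_of_le {F : Type*} [NormedAddCommGroup F]
    {y : ℕ → StrongDual ℝ X} (hy : ∀ j, 0 ≤ y j) {f : ℕ → F} {J : Finset ℕ} {α β : ℝ}
    (hα : 0 < α) (hβ : 0 < β) (hyα : weakNorm q y ≤ ENNReal.ofReal α)
    (hf : strongNorm p ((J : Set ℕ).indicator f) ≤ ENNReal.ofReal β) (u : ℕ → E)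
    (hu : ∀ j, ‖u j‖ ≤ ‖f j‖) : ‖∑ j ∈ J, posTmul p q (y j) (u j)‖ ≤ α * β := by
  refine norm_sum_posTmul_le p q hy hα hβ hyα (le_trans ?_ hf)
  refine lpSize_mono fun n => ?_
  by_cases hn : n ∈ (J : Set ℕ)
  · simp only [Set.indicator_of_mem hn]
    exact enorm_le_iff_norm_le.2 (hu n)
  · simp [hn]

/-- The tails of (f_j) are small in the p-norm, which for `p = ∞` uses that the sequence is
norm-null. The block estimate in V survives passage to second adjoints, giving the Cauchy criterion
in the complete space V^{**}. -/
lemma summable_bidualMap_posTmul {y : ℕ → StrongDual ℝ X} (hy : ∀ j, 0 ≤ y j)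
    (hyw : IsWeaklyPSummable q y) {f : ℕ → StrongDual ℝ (StrongDual ℝ E)} (hf : IsPSummable p f) :
    Summable fun j => bidualMap E _ (posTmul p q (y j)) (f j) := by
  have hp1 : 1 ≤ p := ENNReal.HolderConjugate.one_le p q
  rw [summable_iff_vanishing_norm]
  intro ε hε
  set α := (weakNorm q y).toReal + 1
  have hα : 0 < α := by positivity
  have hyα : weakNorm q y ≤ ENNReal.ofReal α := by
    rw [ENNReal.le_ofReal_iff_toReal_le hyw.ne hα.le]; simp [α]
  obtain ⟨s, hs⟩ := exists_finset_strongNorm_indicator_le p hp1 hf (ε := ε / (2 * α))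
    (by positivity)
  refine ⟨s, fun J hJ => ?_⟩
  refine (norm_sum_bidualMap_le (fun j => norm_nonneg (f j)) (fun u hu =>
    norm_sum_posTmul_le_of_le p q hy hα (by positivity) hyα (hs J hJ) u hu) f
    fun j => le_rfl).trans_lt ?_
  field_simp
  linarith

lemma norm_tsum_bidualMap_posTmul_le {y : ℕ → StrongDual ℝ X} (hy : ∀ j, 0 ≤ y j)
    {f : ℕ → StrongDual ℝ (StrongDual ℝ E)} (hf : IsPSummable p f) {α β : ℝ}
    (hα : 0 < α) (hβ : 0 < β) (hyα : weakNorm q y ≤ ENNReal.ofReal α)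
    (hfβ : strongNorm p f ≤ ENNReal.ofReal β) :
    ‖∑' j, bidualMap E _ (posTmul p q (y j)) (f j)‖ ≤ α * β := by
  have hsum := summable_bidualMap_posTmul p q hy (hyα.trans_lt ENNReal.ofReal_lt_top) hf
  refine le_of_tendsto hsum.hasSum.norm (Eventually.of_forall fun J => ?_)
  exact norm_sum_bidualMap_le (fun j => norm_nonneg (f j)) (fun u hu =>
    norm_sum_posTmul_le_of_le p q hy hα hβ hyα
      ((strongNorm_indicator_le p f _).trans hfβ) u hu) f fun j => le_rfl

variable {p q}

omit hpq [IsOrderedModule ℝ X] [HasSolidNorm X] [Lattice X] [IsOrderedAddMonoid X] in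
/-- The functionals on `E^{**}` that vanish on `E` annihilate a representation of an adjoint. -/
lemma hasSum_apply_smul_zero {T : X →L[ℝ] E} {f : ℕ → StrongDual ℝ (StrongDual ℝ E)}
    {y : ℕ → StrongDual ℝ X} (h : HasSum (fun j => (f j).smulRight (y j)) (adjointOp T))
    {ψ : StrongDual ℝ (StrongDual ℝ (StrongDual ℝ E))}
    (hψ : ∀ u, ψ (NormedSpace.inclusionInDoubleDual ℝ E u) = 0) :
    HasSum (fun j => ψ (f j) • y j) 0 := by
  -- Θ sends S to x ↦ ψ(e ↦ (S e)(x)). On T^* this is ψ evaluated at the image of T x in E^{**},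
  -- hence 0; on f ⊗ y it is ψ(f) y.
  let Θ : (StrongDual ℝ E →L[ℝ] StrongDual ℝ X) →L[ℝ] StrongDual ℝ X :=
    (ContinuousLinearMap.compL ℝ X (StrongDual ℝ (StrongDual ℝ E)) ℝ ψ) ∘L
      (ContinuousLinearMap.flipₗᵢ ℝ (StrongDual ℝ E) X ℝ).toContinuousLinearEquiv.toContinuousLinearMap
  have h1 := h.mapL Θ
  have h2 : Θ (adjointOp T) = 0 := by
    ext x
    exact hψ (T x)
  rw [h2] at h1
  convert h1 using 2 with j
  ext x
  have h3 : ((f j).smulRight (y j)).flip x = (y j x) • f j := by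
    ext e
    simp [mul_comm]
  change ψ (f j) * y j x = ψ (((f j).smulRight (y j)).flip x)
  rw [h3, map_smul, smul_eq_mul, mul_comm]

/-- Under the approximation hypotheses, the tensor of `T^*` in `(X^* ⊗ E)^{**}` is a limit of
elements of `X^* ⊗ E`. -/
lemma exists_norm_tsum_sub_lt
    (happrox : HasAP (StrongDual ℝ (StrongDual ℝ (StrongDual ℝ E))) ∨ HasPMAP (StrongDual ℝ X))
    {T : X →L[ℝ] E} {f : ℕ → StrongDual ℝ (StrongDual ℝ E)} {y : ℕ → StrongDual ℝ X}
    (hy : ∀ j, 0 ≤ y j) (hyw : IsWeaklyPSummable q y) (hf : IsPSummable p f)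
    (h : HasSum (fun j => (f j).smulRight (y j)) (adjointOp T)) {δ : ℝ} (hδ : 0 < δ) :
    ∃ t : PosTensor p q X E, ‖∑' j, bidualMap E _ (posTmul p q (y j)) (f j) -
      NormedSpace.inclusionInDoubleDual ℝ _ t‖ < δ := by
  have hp1 : 1 ≤ p := ENNReal.HolderConjugate.one_le p q
  refine exists_norm_sub_lt_of_forall_dual _ _ (fun Ψ hΨ => ?_) hδ
  set V := PosTensor p q X E
  let U : StrongDual ℝ X →L[ℝ] StrongDual ℝ (StrongDual ℝ (StrongDual ℝ E)) :=
    (ContinuousLinearMap.compL ℝ (StrongDual ℝ (StrongDual ℝ E)) (StrongDual ℝ (StrongDual ℝ V)) ℝ Ψ)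
      ∘L bidualMap E V ∘L posTmul p q
  have hU : ∀ x u, U x (NormedSpace.inclusionInDoubleDual ℝ E u) = 0 := fun x u => by
    change Ψ (bidualMap E V (posTmul p q x) _) = 0
    rw [bidualMap_inclusion]
    exact hΨ _
  have ht : HasSum (fun j => U (y j) (f j))
      (Ψ (∑' j, bidualMap E V (posTmul p q (y j)) (f j))) :=
    (summable_bidualMap_posTmul p q hy hyw hf).hasSum.mapL Ψ
  set α := (weakNorm q y).toReal + 1
  have hα : 0 < α := by positivity
  have hyα : weakNorm q y ≤ ENNReal.ofReal α := by
    rw [ENNReal.le_ofReal_iff_toReal_le hyw.ne hα.le]; simp [α]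
  have hbound : ∀ y' : ℕ → StrongDual ℝ X, (∀ j, 0 ≤ y' j) → weakNorm q y' ≤ ENNReal.ofReal α →
      ∀ β : ℝ, 0 < β → ∀ J : Finset ℕ,
      strongNorm p ((J : Set ℕ).indicator f) ≤ ENNReal.ofReal β →
      ∑ j ∈ J, ‖f j‖ * ‖U (y' j)‖ ≤ α * β * ‖Ψ‖ := fun y' hy' hyα' β hβ J hJ =>
    sum_mul_norm_comp_bidualMap_le (fun j => norm_nonneg (f j)) (fun u hu =>
      norm_sum_posTmul_le_of_le p q hy' hα hβ hyα' hJ u hu) Ψ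
  rcases happrox with hAP | hPMAP
  · rw [← ht.tsum_eq]
    -- The projection of E^{***} onto the annihilator of E along the canonical copy of E^*. It fixes
    -- every U(y_j), and Q g annihilates E for every g.
    let Q : StrongDual ℝ (StrongDual ℝ (StrongDual ℝ E)) →L[ℝ]
        StrongDual ℝ (StrongDual ℝ (StrongDual ℝ E)) :=
      ContinuousLinearMap.id ℝ _ - NormedSpace.inclusionInDoubleDual ℝ (StrongDual ℝ E) ∘L
        (NormedSpace.inclusionInDoubleDual ℝ E).precomp ℝ
    have hQ : ∀ ψ g, Q ψ g = ψ g - g (ψ.comp (NormedSpace.inclusionInDoubleDual ℝ E)) :=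
      fun ψ g => rfl
    refine hAP.tsum_apply_eq_zero Q
      (φ := fun j => NormedSpace.inclusionInDoubleDual ℝ (StrongDual ℝ (StrongDual ℝ E)) (f j))
      (h := fun j => U (y j)) ?_ (fun j => ?_) (fun g => ?_)
    · set β := (strongNorm p f).toReal + 1
      have hβ : 0 < β := by positivity
      have hfβ : strongNorm p f ≤ ENNReal.ofReal β := by
        rw [ENNReal.le_ofReal_iff_toReal_le hf.1.ne hβ.le]; simp [β]
      refine Summable.of_nonneg_of_le (fun j => by positivity) (fun j =>
        mul_le_mul_of_nonneg_right (NormedSpace.double_dual_bound ℝ _ (f j)) (norm_nonneg _)) ?_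
      exact summable_of_sum_le (fun j => by positivity) fun J =>
        hbound y hy hyα β hβ J ((strongNorm_indicator_le p f _).trans hfβ)
    · ext g
      have h1 : (U (y j)).comp (NormedSpace.inclusionInDoubleDual ℝ E) = 0 := by
        ext u; exact hU _ u
      rw [hQ, h1, map_zero, sub_zero]
    · have h1 := (hasSum_apply_smul_zero h (ψ := Q g) fun u => by
        rw [hQ]; exact sub_self _).mapL U
      simpa using h1
  · refine hPMAP.hasSum_apply_eq_zero U ht (fun ε hε => ?_) fun e =>
      hasSum_apply_smul_zero h (hU e)
    obtain ⟨s, hs⟩ := exists_finset_strongNorm_indicator_le p hp1 hf (ε := ε / (α * (‖Ψ‖ + 1)))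
      (by positivity)
    refine ⟨s, fun R hR hR1 J hJ => ?_⟩
    -- Here positivity and contractivity of R are both used: the R y_j stay nonnegative and their
    -- weak norm does not grow, so the tail bound is uniform in R.
    refine (hbound _ (fun j => hR _ (hy j)) ((weakNorm_map_le R hR1 y).trans hyα) _
      (by positivity) J (hs J hJ)).trans ?_
    have h1 : α * (ε / (α * (‖Ψ‖ + 1))) * ‖Ψ‖ = ε * (‖Ψ‖ / (‖Ψ‖ + 1)) := by field_simp
    rw [h1]
    exact mul_le_of_le_one_right hε.le (div_le_one_of_le₀ (by linarith) (by positivity))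

end Closure

/-! ### From tensors to representations -/

section Main

variable (p q : ℝ≥0∞) [hpq : ENNReal.HolderConjugate p q]
variable {X E : Type*} [NormedAddCommGroup X] [NormedSpace ℝ X] [Lattice X]
  [IsOrderedAddMonoid X] [IsOrderedModule ℝ X] [HasSolidNorm X]
  [NormedAddCommGroup E] [NormedSpace ℝ E]

lemma norm_posTensorOp_le (t : PosTensor p q X E) : ‖posTensorOp p q t‖ ≤ ‖t‖ := by
  refine ((posTensorOp p q).le_of_opNorm_le (c := 1) ?_ t).trans_eq (one_mul _)
  exact LinearMap.mkContinuous_norm_le _ zero_le_one _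

/-- The Cauchy estimate is made in the tensor product, which need not be complete, and pushed by a
contraction into L(X, E), which is complete because E is. -/
lemma summable_smulRight [CompleteSpace E] {a : ℕ → StrongDual ℝ X} (ha : ∀ j, 0 ≤ a j)
    (haw : IsWeaklyPSummable q a) {u : ℕ → E} (hu : IsPSummable p u) :
    Summable fun j => (a j).smulRight (u j) := by
  have hp1 : 1 ≤ p := ENNReal.HolderConjugate.one_le p q
  rw [summable_iff_vanishing_norm]
  intro ε hε
  set α := (weakNorm q a).toReal + 1
  have hα : 0 < α := by positivity
  have haα : weakNorm q a ≤ ENNReal.ofReal α := by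
    rw [ENNReal.le_ofReal_iff_toReal_le haw.ne hα.le]; simp [α]
  obtain ⟨s, hs⟩ := exists_finset_strongNorm_indicator_le p hp1 hu (ε := ε / (2 * α))
    (by positivity)
  refine ⟨s, fun J hJ => ?_⟩
  have h1 : ∑ j ∈ J, (a j).smulRight (u j) =
      posTensorOp p q (∑ j ∈ J, posTmul p q (a j) (u j)) := by
    simp_rw [map_sum, posTensorOp_posTmul]
  rw [h1]
  refine ((norm_posTensorOp_le p q _).trans
    (norm_sum_posTmul_le p q ha hα (by positivity) haα (hs J hJ))).trans_lt ?_
  field_simp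
  linarith

omit [NormedSpace ℝ E] in
-- Norms of at least η can occur only in the finitely many blocks with B_k ≥ η, and each block has
-- finite support. This supplies the null-sequence condition for `p = ∞`.
lemma tendsto_blocks_zero (hp1 : 1 ≤ p) {u : ℕ → ℕ → E} {s : ℕ → Finset ℕ} {B : ℕ → ℝ}
    (hB : Tendsto B atTop (𝓝 0)) (hu : ∀ k, strongNorm p (u k) ≤ ENNReal.ofReal (B k))
    (hB0 : ∀ k, 0 ≤ B k) (hus : ∀ k, ∀ j ∉ s k, u k j = 0) :
    Tendsto (fun n => u (Nat.unpair n).1 (Nat.unpair n).2) atTop (𝓝 0) := by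
  rw [← Nat.cofinite_eq_atTop, Metric.tendsto_nhds]
  intro η hη
  obtain ⟨N, hN⟩ := eventually_atTop.1 (hB.eventually (Iio_mem_nhds hη))
  rw [eventually_cofinite]
  refine (((Finset.range N).biUnion fun k => (s k).image fun j =>
    Nat.pair k j).finite_toSet).subset fun n hn => ?_
  simp only [Finset.coe_biUnion, Set.mem_iUnion, Finset.coe_image, Set.mem_image]
  refine ⟨(Nat.unpair n).1, ?_, (Nat.unpair n).2, ?_, Nat.pair_unpair n⟩
  · by_contra hk
    simp only [Finset.coe_range, Set.mem_Iio, not_lt] at hk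
    refine hn ?_
    rw [dist_zero_right]
    refine lt_of_le_of_lt ?_ (hN _ hk)
    rw [← ENNReal.ofReal_le_ofReal_iff (hB0 _), ofReal_norm]
    exact (le_lpSize hp1 (fun j => ‖u (Nat.unpair n).1 j‖ₑ) _).trans (hu _)
  · by_contra hj
    refine hn ?_
    rw [hus _ _ hj, dist_self]
    exact hη

lemma tsum_ofReal_le (α : ℝ) (hα : 0 ≤ α) (κ : ℕ → NNReal) :
    ∑' k, ENNReal.ofReal ((if k = 0 then α else 0) + κ k) ≤
      ENNReal.ofReal α + ∑' k, (κ k : ℝ≥0∞) := by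
  have h1 : ∀ k, ENNReal.ofReal ((if k = 0 then α else 0) + κ k) =
      (if k = 0 then ENNReal.ofReal α else 0) + (κ k : ℝ≥0∞) := fun k => by
    rw [ENNReal.ofReal_add (by split_ifs <;> simp [hα]) (κ k).coe_nonneg, ENNReal.ofReal_coe_nnreal]
    split_ifs <;> simp
  simp_rw [h1]
  rw [ENNReal.tsum_add, tsum_ite_eq]

set_option maxHeartbeats 1000000 in
/-- An operator whose adjoint has a tensor that is a limit of elements of `X^* ⊗ E` is positively
nuclear, with control of the norms. -/
lemma exists_isPositivelyNuclearRep [CompleteSpace E] (T : X →L[ℝ] E)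
    (z : StrongDual ℝ (StrongDual ℝ (PosTensor p q X E)))
    (hz : ∀ δ : ℝ, 0 < δ → ∃ t, ‖z - NormedSpace.inclusionInDoubleDual ℝ _ t‖ < δ)
    (hzT : ∀ (x : X) (e : StrongDual ℝ E), z ((e ∘L (ContinuousLinearMap.apply ℝ E x)) ∘L
      posTensorOp p q) = e (T x))
    {α β : ℝ} (hα : 0 ≤ α) (hβ : 0 ≤ β) (hzn : ‖z‖ ≤ α * β) {ε : ℝ≥0∞} (hε : 0 < ε)
    (hε' : ε ≠ ∞) :
    ∃ (a : ℕ → StrongDual ℝ X) (u : ℕ → E), (∀ j, 0 ≤ a j) ∧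
      weakNorm q a ≤ ENNReal.ofReal α + ε ∧ strongNorm p u ≤ ENNReal.ofReal β + ε ∧
      IsPSummable p u ∧ HasSum (fun j => (a j).smulRight (u j)) T := by
  have hp1 : 1 ≤ p := ENNReal.HolderConjugate.one_le p q
  have hq1 : 1 ≤ q := ENNReal.HolderConjugate.one_le q p
  obtain ⟨κ, hκ0, hκ⟩ := ENNReal.exists_pos_sum_of_countable hε.ne' ℕ
  have hκs : Tendsto (fun k => (κ k : ℝ)) atTop (𝓝 0) := by
    have h1 : Summable κ := ENNReal.tsum_coe_ne_top_iff_summable.1 (hκ.trans_le le_top).ne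
    exact (NNReal.summable_coe.2 h1).tendsto_atTop_zero
  have hκ0' : ∀ k, (0 : ℝ) < κ k := fun k => hκ0 k
  -- Chosen so that δ_k + δ_{k+1} ≤ κ_{k+1}²: the difference t_{k+1} - t_k then splits with both
  -- factors equal to κ_{k+1}. Only block 0 carries α and β, so the totals exceed these by at most ∑
  -- κ_k < ε.
  set δ : ℕ → ℝ := fun k => min ((κ k : ℝ) ^ 2) ((κ (k + 1) : ℝ) ^ 2) / 2
  have hδ : ∀ k, 0 < δ k := fun k => by
    have := hκ0' k; have := hκ0' (k + 1); positivity
  have hδ1 : ∀ k, δ k ≤ (κ k : ℝ) ^ 2 / 2 := fun k => by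
    simp only [δ]; gcongr; exact min_le_left _ _
  have hδ2 : ∀ k, δ k ≤ (κ (k + 1) : ℝ) ^ 2 / 2 := fun k => by
    simp only [δ]; gcongr; exact min_le_right _ _
  choose t ht using fun k => hz (δ k) (hδ k)
  let d : ℕ → PosTensor p q X E := fun k => Nat.casesOn k (t 0) fun k => t (k + 1) - t k
  have hdsum : ∀ n, ∑ k ∈ Finset.range (n + 1), d k = t n := fun n => by
    rw [Finset.sum_range_succ', Finset.sum_range_sub t]
    simp [d]
  set ι := NormedSpace.inclusionInDoubleDual ℝ (PosTensor p q X E)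
  have hι : ∀ t, ‖ι t‖ = ‖t‖ := fun t =>
    (NormedSpace.inclusionInDoubleDualLi (E := PosTensor p q X E) ℝ).norm_map t
  set A : ℕ → ℝ := fun k => (if k = 0 then α else 0) + κ k
  set B : ℕ → ℝ := fun k => (if k = 0 then β else 0) + κ k
  have hA : ∀ k, 0 < A k := fun k =>
    add_pos_of_nonneg_of_pos (by split_ifs <;> simp [hα]) (hκ0' k)
  have hB : ∀ k, 0 < B k := fun k =>
    add_pos_of_nonneg_of_pos (by split_ifs <;> simp [hβ]) (hκ0' k)
  have hd : ∀ k, ‖d k‖ < A k * B k := by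
    intro k
    cases k with
    | zero =>
      have h1 : ‖t 0‖ ≤ ‖z‖ + ‖z - ι (t 0)‖ := by
        rw [← hι]
        calc ‖ι (t 0)‖ = ‖z - (z - ι (t 0))‖ := by rw [sub_sub_cancel]
          _ ≤ _ := norm_sub_le _ _
      have h2 := ht 0
      have h3 := hδ1 0
      have h4 := hκ0' 0
      change ‖t 0‖ < (α + κ 0) * (β + κ 0)
      nlinarith [mul_nonneg hα h4.le, mul_nonneg hβ h4.le]
    | succ k =>
      have h1 : ‖t (k + 1) - t k‖ ≤ ‖z - ι (t k)‖ + ‖z - ι (t (k + 1))‖ := by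
        rw [← hι, map_sub]
        calc ‖ι (t (k + 1)) - ι (t k)‖ = ‖(z - ι (t k)) - (z - ι (t (k + 1)))‖ := by
              congr 1; abel
          _ ≤ _ := norm_sub_le _ _
      have h2 := ht k
      have h3 := ht (k + 1)
      have h4 := hδ2 k
      have h5 := hδ1 (k + 1)
      change ‖t (k + 1) - t k‖ < (0 + (κ (k + 1) : ℝ)) * (0 + κ (k + 1))
      nlinarith
  choose s a u ha haw hu hus hdrep using fun k => exists_rep_of_norm_lt p q (hA k) (hd k)
  have hweak : weakNorm q (fun n => a (Nat.unpair n).1 (Nat.unpair n).2) ≤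
      ENNReal.ofReal α + ε :=
    (weakNorm_prod_le hq1 a).trans ((ENNReal.tsum_le_tsum haw).trans
      ((tsum_ofReal_le α hα κ).trans (by gcongr)))
  have hstrong : strongNorm p (fun n => u (Nat.unpair n).1 (Nat.unpair n).2) ≤
      ENNReal.ofReal β + ε :=
    (strongNorm_prod_le hp1 u).trans ((ENNReal.tsum_le_tsum hu).trans
      ((tsum_ofReal_le β hβ κ).trans (by gcongr)))
  have hBlim : Tendsto B atTop (𝓝 0) := by
    refine hκs.congr' ((eventually_ge_atTop 1).mono fun k hk => ?_)
    simp [B, (zero_lt_one.trans_le hk).ne']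
  have hps : IsPSummable p (fun n => u (Nat.unpair n).1 (Nat.unpair n).2) :=
    ⟨hstrong.trans_lt (ENNReal.add_lt_top.2 ⟨ENNReal.ofReal_lt_top, hε'.lt_top⟩),
      fun _ => tendsto_blocks_zero p hp1 hBlim hu (fun k => (hB k).le) hus⟩
  refine ⟨_, _, fun n => ha _ _, hweak, hstrong, hps, ?_⟩
  obtain ⟨S, hS⟩ := summable_smulRight p q (fun n => ha (Nat.unpair n).1 (Nat.unpair n).2)
    (hweak.trans_lt (ENNReal.add_lt_top.2 ⟨ENNReal.ofReal_lt_top, hε'.lt_top⟩)) hps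
  suffices hST : S = T by rwa [hST] at hS
  have hS2 : HasSum (fun z : ℕ × ℕ => (a z.1 z.2).smulRight (u z.1 z.2)) S :=
    (Nat.pairEquiv.symm.hasSum_iff (f := fun z : ℕ × ℕ => (a z.1 z.2).smulRight (u z.1 z.2))).1 hS
  have hrow : ∀ k, HasSum (fun j => (a k j).smulRight (u k j)) (posTensorOp p q (d k)) := fun k => by
    rw [hdrep, map_sum]
    simp_rw [posTensorOp_posTmul]
    exact hasSum_sum_of_ne_finset_zero fun j hj => by rw [hus k j hj]; ext; simp
  have hlim : Tendsto (fun n => posTensorOp p q (t n)) atTop (𝓝 S) := by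
    have h1 := (hS2.prod_fiberwise hrow).tendsto_sum_nat.comp (tendsto_add_atTop_nat 1)
    refine h1.congr fun n => ?_
    simp only [Function.comp]
    rw [← map_sum, hdsum]
  have hδlim : Tendsto δ atTop (𝓝 0) := by
    refine squeeze_zero (fun k => (hδ k).le) hδ1 ?_
    simpa using (hκs.pow 2).div_const 2
  have hιlim : Tendsto (fun n => ι (t n)) atTop (𝓝 z) := by
    rw [tendsto_iff_norm_sub_tendsto_zero]
    refine squeeze_zero (fun n => norm_nonneg _) (fun n => ?_) hδlim
    rw [norm_sub_rev]; exact (ht n).le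
  ext x
  refine (SeparatingDual.eq_iff_forall_dual_eq (R := ℝ)).2 fun e => ?_
  rw [← hzT]
  -- Evaluating t_n at Φ has limit z(Φ) = e(T x) by convergence in the bidual, and limit e(S x) by
  -- convergence of the partial block sums.
  set Φ := (e ∘L (ContinuousLinearMap.apply ℝ E x)) ∘L posTensorOp p q
  have h1 : Tendsto (fun n => ι (t n) Φ) atTop (𝓝 (z Φ)) :=
    (((ContinuousLinearMap.apply ℝ ℝ Φ).continuous.tendsto z).comp hιlim)
  have h2 : Tendsto (fun n => ι (t n) Φ) atTop (𝓝 (e (S x))) :=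
    ((e ∘L (ContinuousLinearMap.apply ℝ E x)).continuous.tendsto S).comp hlim
  exact tendsto_nhds_unique h2 h1

variable {p q}

omit [IsOrderedModule ℝ X] [HasSolidNorm X] in
-- The adjoint of a ⊗ u is the canonical image of u in E^{**} tensored with a, and the embedding is
-- isometric.
lemma IsPositivelyNuclearRep.isLatticiallyNuclearRep {T : X →L[ℝ] E} {a : ℕ → StrongDual ℝ X}
    {u : ℕ → E} (h : IsPositivelyNuclearRep p T a u) :
    IsLatticiallyNuclearRep p (adjointOp T)
      (fun j => NormedSpace.inclusionInDoubleDual ℝ E (u j)) a ∧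
      strongNorm p (fun j => NormedSpace.inclusionInDoubleDual ℝ E (u j)) = strongNorm p u := by
  have hn : strongNorm p (fun j => NormedSpace.inclusionInDoubleDual ℝ E (u j)) =
      strongNorm p u := by
    simp_rw [strongNorm_eq_lpSize]
    congr 1
    ext j
    exact enorm_eq_iff_norm_eq.2 ((NormedSpace.inclusionInDoubleDualLi (E := E) ℝ).norm_map (u j))
  refine ⟨⟨⟨hn ▸ h.summable.1, fun hp => ?_⟩, h.weaklySummable, h.nonneg, ?_⟩, hn⟩
  · have h1 := ((NormedSpace.inclusionInDoubleDual ℝ E).continuous.tendsto 0).comp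
      (h.summable.2 hp)
    rwa [map_zero] at h1
  · have h1 := h.hasSum.mapL (ContinuousLinearMap.compL ℝ X E ℝ).flip
    change HasSum _ ((ContinuousLinearMap.compL ℝ X E ℝ).flip T)
    convert h1 using 2 with j
    ext e x
    simp [mul_comm]

/-- Representations of `T^*` give representations of `T` with almost the same norms. -/
lemma IsLatticiallyNuclearRep.exists_isPositivelyNuclearRep [CompleteSpace E]
    (hp : 1 ≤ p)
    (happrox : HasAP (StrongDual ℝ (StrongDual ℝ (StrongDual ℝ E))) ∨ HasPMAP (StrongDual ℝ X))
    {T : X →L[ℝ] E} {f : ℕ → StrongDual ℝ (StrongDual ℝ E)} {y : ℕ → StrongDual ℝ X}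
    (h : IsLatticiallyNuclearRep p (adjointOp T) f y) {ε : ℝ≥0∞} (hε : 0 < ε) (hε' : ε ≠ ∞) :
    ∃ (a : ℕ → StrongDual ℝ X) (u : ℕ → E), IsPositivelyNuclearRep p T a u ∧
      weakNorm p.conjExponent a ≤ weakNorm p.conjExponent y + ε ∧
      strongNorm p u ≤ strongNorm p f + ε := by
  have : ENNReal.HolderConjugate p p.conjExponent := ENNReal.HolderConjugate.conjExponent hp
  set q := p.conjExponent
  set z := ∑' j, bidualMap E _ (posTmul p q (y j)) (f j)
  have hsum := summable_bidualMap_posTmul p q h.nonneg h.weaklySummable h.summable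
  obtain ⟨η, hη0, hη⟩ : ∃ η : NNReal, 0 < η ∧ (η : ℝ≥0∞) ≤ ε / 2 := by
    refine ⟨(ε / 2).toNNReal, ENNReal.toNNReal_pos (ENNReal.half_pos hε.ne').ne'
      (ENNReal.div_ne_top hε' (by simp)), ?_⟩
    rw [ENNReal.coe_toNNReal (ENNReal.div_ne_top hε' (by simp))]
  have hy_top : weakNorm q y ≠ ∞ := h.weaklySummable.ne
  have hf_top : strongNorm p f ≠ ∞ := h.summable.1.ne
  have hη0' : (0 : ℝ) < η := hη0
  -- The added η keeps α and β positive even when a norm is 0; it uses half of ε, and the block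
  -- construction uses the other half.
  set α := (weakNorm q y).toReal + η
  set β := (strongNorm p f).toReal + η
  have hα : 0 < α := by positivity
  have hβ : 0 < β := by positivity
  have heα : ENNReal.ofReal α = weakNorm q y + η := by
    rw [ENNReal.ofReal_add ENNReal.toReal_nonneg hη0'.le, ENNReal.ofReal_toReal hy_top,
      ENNReal.ofReal_coe_nnreal]
  have heβ : ENNReal.ofReal β = strongNorm p f + η := by
    rw [ENNReal.ofReal_add ENNReal.toReal_nonneg hη0'.le, ENNReal.ofReal_toReal hf_top,
      ENNReal.ofReal_coe_nnreal]
  obtain ⟨a, u, ha, haw, hu, hups, hT⟩ := BanachLattice.exists_isPositivelyNuclearRep p q T z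
    (fun δ hδ => exists_norm_tsum_sub_lt happrox h.nonneg h.weaklySummable h.summable h.hasSum hδ)
    (fun x e => by
      -- Evaluated at the functional t ↦ e(t x), the series for z becomes ∑ f_j(e) y_j(x) = (T^*
      -- e)(x).
      have h1 := hsum.hasSum.mapL (ContinuousLinearMap.apply ℝ ℝ
        ((e ∘L (ContinuousLinearMap.apply ℝ E x)) ∘L posTensorOp p q))
      have h2 : HasSum (fun j => f j e * y j x) (e (T x)) :=
        h.hasSum.mapL ((ContinuousLinearMap.apply ℝ ℝ x) ∘L
          (ContinuousLinearMap.apply ℝ (StrongDual ℝ X) e))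
      have h4 : (fun j => f j e * y j x) = fun j => ContinuousLinearMap.apply ℝ ℝ
          ((e ∘L (ContinuousLinearMap.apply ℝ E x)) ∘L posTensorOp p q)
          (bidualMap E _ (posTmul p q (y j)) (f j)) := by
        funext j
        have h3 : ((e ∘L (ContinuousLinearMap.apply ℝ E x)) ∘L posTensorOp p q).comp
            (posTmul p q (y j)) = y j x • e := by
          ext v
          change e (posTensorOp p q (posTmul p q (y j) v) x) = y j x * e v
          rw [posTensorOp_posTmul]
          simp
        change f j e * y j x = bidualMap E _ (posTmul p q (y j)) (f j) _
        rw [bidualMap_apply, h3, map_smul, smul_eq_mul, mul_comm]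
      exact h1.unique (h4 ▸ h2))
    hα.le hβ.le
    (norm_tsum_bidualMap_posTmul_le p q h.nonneg h.summable hα hβ
      (heα ▸ le_self_add) (heβ ▸ le_self_add))
    (ε := ε / 2) (ENNReal.half_pos hε.ne') (ENNReal.div_ne_top hε' (by simp))
  have hle : ∀ c : ℝ≥0∞, c + η + ε / 2 ≤ c + ε := fun c => by
    rw [add_assoc]
    calc c + (η + ε / 2) ≤ c + (ε / 2 + ε / 2) := by gcongr
      _ = c + ε := by rw [ENNReal.add_halves]
  rw [heα] at haw
  rw [heβ] at hu
  have haw' := haw.trans (hle _)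
  exact ⟨a, u, ⟨haw'.trans_lt (ENNReal.add_lt_top.2 ⟨hy_top.lt_top, hε'.lt_top⟩), ha, hups, hT⟩,
    haw', hu.trans (hle _)⟩

end Main

end BanachLattice

/-! ### Comparison of the two infima -/

theorem mainTheorem3 {X E : Type*}
    [NormedAddCommGroup X] [NormedSpace ℝ X] [CompleteSpace X] [Lattice X]
    [IsOrderedAddMonoid X] [IsOrderedModule ℝ X] [HasSolidNorm X]
    [NormedAddCommGroup E] [NormedSpace ℝ E] [CompleteSpace E]
    (p : ENNReal) (hp : 1 ≤ p)
    (happrox : BanachLattice.HasAP (StrongDual ℝ (StrongDual ℝ (StrongDual ℝ E))) ∨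
      BanachLattice.HasPMAP (StrongDual ℝ X))
    (T : X →L[ℝ] E)
    (hT : BanachLattice.IsLatticiallyNuclear p (BanachLattice.adjointOp T)) :
    BanachLattice.IsPositivelyNuclear p T ∧
      BanachLattice.positivelyNuclearNorm p T =
        BanachLattice.latticiallyNuclearNorm p (BanachLattice.adjointOp T) := by
  refine ⟨?_, le_antisymm ?_ ?_⟩
  · obtain ⟨f, y, h⟩ := hT
    obtain ⟨a, u, hau, -⟩ := h.exists_isPositivelyNuclearRep hp happrox one_pos ENNReal.one_ne_top
    exact ⟨a, u, hau⟩
  · refine le_iInf fun f => le_iInf fun y => le_iInf fun h => ?_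
    have key : ∀ ε : ℝ≥0∞, 0 < ε → ε ≠ ∞ → BanachLattice.positivelyNuclearNorm p T ≤
        (BanachLattice.strongNorm p f + ε) * (BanachLattice.weakNorm p.conjExponent y + ε) := by
      intro ε hε hε'
      obtain ⟨a, u, hau, haw, hu⟩ := h.exists_isPositivelyNuclearRep hp happrox hε hε'
      refine (iInf₂_le_of_le a u (iInf_le _ hau)).trans ?_
      rw [mul_comm]
      exact mul_le_mul' hu haw
    have hlim : Tendsto (fun ε : ℝ≥0∞ => (BanachLattice.strongNorm p f + ε) *
        (BanachLattice.weakNorm p.conjExponent y + ε)) (𝓝[>] 0)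
        (𝓝 ((BanachLattice.strongNorm p f + 0) *
          (BanachLattice.weakNorm p.conjExponent y + 0))) := by
      -- Multiplication on [0, ∞] is discontinuous at (0, ∞), so finiteness of both norms is needed
      -- for the limit.
      refine Tendsto.mono_left ?_ nhdsWithin_le_nhds
      refine ENNReal.Tendsto.mul (tendsto_const_nhds.add tendsto_id) (Or.inr ?_)
        (tendsto_const_nhds.add tendsto_id) (Or.inr ?_)
      · simpa using h.weaklySummable.ne
      · simpa using h.summable.1.ne
    have := ge_of_tendsto hlim (by
      filter_upwards [Ioo_mem_nhdsGT (zero_lt_one' ℝ≥0∞)] with ε hε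
      exact key ε hε.1 (hε.2.trans ENNReal.one_lt_top).ne)
    simpa using this
  · refine le_iInf fun a => le_iInf fun u => le_iInf fun h => ?_
    obtain ⟨h1, h2⟩ := h.isLatticiallyNuclearRep
    refine (iInf₂_le_of_le _ a (iInf_le _ h1)).trans ?_
    rw [h2, mul_comm]
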